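/- **Setting.** Let $S=\{1,2,3\}$, fix $c\in(0,1/2)$ and set $$\psi_1(x,y)=\tfrac12(1-x,y),\qquad \psi_2(x,y)=\tfrac12(1+x,-y),\qquad \psi_3(x,y)=\left(\tfrac12+cy,\,cx\right),\qquad (x,y)\in\mathbb R^2 .$$ Let $T\subset\mathbb R^2$ be the unique non-empty compact set with $T=\bigcup_{i\in S}\psi_i(T)$. For a finite word $i=(i_1,\dots,i_n)$ over $S$ write $|i|=n$ and $\psi_i=\psi_{i_1}\circ\dots\circ\psi_{i_n}$; let $V^0=\{(0,0),(1,0)\}$, $V^n=\bigcup_{|i|=n}\psi_i(V^0)$ and $V^*=\bigcup_{n\ge 0}V^n$. Let $(w(i))$, indexed by the non-empty finite words over $S$, be random variables on a probability space $(\Omega,P)$ with values in $[0,1]$, almost surely non-zero, such that the triples $(w(ij))_{j\in S}$, where $i$ runs over all finite words including the empty word, are independent copies of $(w(j))_{j\in S}$. Put $l(\emptyset)=1$, $l(i)=w(i_1)\,w(i_1i_2)\cdots w(i_1\dots i_n)$ for $i=(i_1,\dots,i_n)$, and $$R_i=\lim_{n\to\infty}\sum_{j\in\{1,2\}^n}\frac{l(ij)}{l(i)}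 .$$ For a function $f$ on $V^*$ let $$\mathcal E^n(f,f)=\sum_{|i|=n}\frac{1}{l(i)R_i}\bigl(f(\psi_i(0,0))-f(\psi_i(1,0))\bigr)^2,\qquad \mathcal E^*(f,f)=\lim_{n\to\infty}\mathcal E^n(f,f),$$ and let $\mathcal F^*$ be the set of $f$ for which the last limit exists and is finite. For $x,y\in V^*$ define $R^*(x,x)=0$ and, for $x\neq y$, $$R^*(x,y)^{-1}=\inf\{\mathcal E^*(f,f): f\in\mathcal F^*,\ f(x)=0,\ f(y)=1\}.$$ For $x,y\in T$ define $R(x,y)=\lim_{n\to\infty}R^*(x_n,y_n)$, where $(x_n),(y_n)$ are any sequences in $V^*$ that converge to $x$ and $y$ in the Euclidean metric. **Theorem.** Suppose that (A) $E(w(1)+w(2))=1$, and (B) $\sum_{i\in S}P(w(i)=1)<1$. Let $\alpha>0$ be the solution of $E\left(\sum_{i\in S}w(i)^\alpha\right)=1$. Then, $P$-almost surely, $R$ is a well-defined metric on $T$ (the limit defining $R(x,y)$ exists for all $x,y\in T$ and all such sequences), and the Hausdorff dimension of the metric space $(T,R)$ satisfies $$\dim_H(T)\le\alpha .$$ -/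

import Mathlib

open MeasureTheory ProbabilityTheory Filter Topology

/-! ## The planar dendrite

The alphabet `S = {1, 2, 3}` is `Fin 3`, with the letters `0, 1, 2` in the roles of `1, 2, 3`.
Finite words are lists over `Fin 3`. The plane is `ℝ × ℝ`; only its topology is used. -/

/-- The three contractions `ψ₁, ψ₂, ψ₃` of the plane, with parameter `c`. -/
noncomputable def psi (c : ℝ) : Fin 3 → ℝ × ℝ → ℝ × ℝ :=
  ![fun p => ((1 - p.1) / 2, p.2 / 2),
    fun p => ((1 + p.1) / 2, -p.2 / 2),
    fun p => (1 / 2 + c * p.2, c * p.1)]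

/-- `T` is the self-similar set of `ψ₁, ψ₂, ψ₃`: the non-empty compact set with
`T = ψ₁(T) ∪ ψ₂(T) ∪ ψ₃(T)` (it exists and is unique, see `existsUnique_isSelfSimilarDendrite`). -/
def IsSelfSimilarDendrite (c : ℝ) (T : Set (ℝ × ℝ)) : Prop :=
  T.Nonempty ∧ IsCompact T ∧ T = ⋃ a : Fin 3, psi c a '' T

theorem psi_lipschitz {c : ℝ} (h0 : 0 < c) (h1 : c < 1 / 2) (a : Fin 3) :
    LipschitzWith (1 / 2) (psi c a) := by
  refine LipschitzWith.of_dist_le_mul fun p q => ?_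
  have e : ((1 / 2 : NNReal) : ℝ) = 1 / 2 := by norm_num
  rw [e, Prod.dist_eq, Prod.dist_eq]
  simp only [Real.dist_eq]
  have m1 := le_max_left |p.1 - q.1| |p.2 - q.2|
  have m2 := le_max_right |p.1 - q.1| |p.2 - q.2|
  have hm : 0 ≤ max |p.1 - q.1| |p.2 - q.2| := (abs_nonneg _).trans m1
  have key : ∀ k x y M : ℝ, 0 ≤ k → k ≤ 1 / 2 → |x - y| ≤ M → 0 ≤ M →
      |k * (x - y)| ≤ 1 / 2 * M := by
    intro k x y M hk hk' hxy hM
    rw [abs_mul, abs_of_nonneg hk]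
    exact mul_le_mul hk' hxy (abs_nonneg _) (by norm_num)
  have k1 := key (1 / 2) _ _ _ (by norm_num) le_rfl m1 hm
  have k2 := key (1 / 2) _ _ _ (by norm_num) le_rfl m2 hm
  have k3 := key c _ _ _ h0.le h1.le m1 hm
  have k4 := key c _ _ _ h0.le h1.le m2 hm
  fin_cases a
  · rw [← abs_neg] at k1
    refine max_le ((le_of_eq (congrArg abs ?_)).trans k1) ((le_of_eq (congrArg abs ?_)).trans k2)
    · change (1 - p.1) / 2 - (1 - q.1) / 2 = _
      ring
    · change p.2 / 2 - q.2 / 2 = _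
      ring
  · rw [← abs_neg] at k2
    refine max_le ((le_of_eq (congrArg abs ?_)).trans k1) ((le_of_eq (congrArg abs ?_)).trans k2)
    · change (1 + p.1) / 2 - (1 + q.1) / 2 = _
      ring
    · change -p.2 / 2 - -q.2 / 2 = _
      ring
  · refine max_le ((le_of_eq (congrArg abs ?_)).trans k4) ((le_of_eq (congrArg abs ?_)).trans k3)
    · change 1 / 2 + c * p.2 - (1 / 2 + c * q.2) = _
      ring
    · change c * p.1 - c * q.1 = _
      ring

/-- The self-similar set exists and is unique. -/
theorem existsUnique_isSelfSimilarDendrite {c : ℝ} (h0 : 0 < c) (h1 : c < 1 / 2) :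
    ∃! T : Set (ℝ × ℝ), IsSelfSimilarDendrite c T := by
  have hL := psi_lipschitz h0 h1
  let F : TopologicalSpace.NonemptyCompacts (ℝ × ℝ) →
      TopologicalSpace.NonemptyCompacts (ℝ × ℝ) := fun K =>
    ⟨⟨⋃ a : Fin 3, psi c a '' (K : Set (ℝ × ℝ)),
      isCompact_iUnion fun a => K.isCompact.image (hL a).continuous⟩,
      Set.nonempty_iUnion.2 ⟨0, K.nonempty.image _⟩⟩
  have hF : ∀ K, ((F K : TopologicalSpace.NonemptyCompacts (ℝ × ℝ)) : Set (ℝ × ℝ)) =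
      ⋃ a : Fin 3, psi c a '' (K : Set (ℝ × ℝ)) := fun K => rfl
  have hmem : ∀ K L : TopologicalSpace.NonemptyCompacts (ℝ × ℝ), ∀ x ∈ (F K : Set (ℝ × ℝ)),
      ∃ y ∈ (F L : Set (ℝ × ℝ)), dist x y ≤ 1 / 2 * dist K L := by
    intro K L x hx
    rw [hF] at hx
    obtain ⟨a, p, hp, rfl⟩ := Set.mem_iUnion.1 hx
    obtain ⟨q, hq, hpq⟩ := L.isCompact.exists_infDist_eq_dist L.nonempty p
    refine ⟨psi c a q, ?_, ?_⟩
    · rw [hF]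
      exact Set.mem_iUnion.2 ⟨a, q, hq, rfl⟩
    · refine ((hL a).dist_le_mul p q).trans ?_
      have e : ((1 / 2 : NNReal) : ℝ) = 1 / 2 := by norm_num
      rw [e, ← hpq]
      refine mul_le_mul_of_nonneg_left ?_ (by norm_num)
      exact Metric.infDist_le_hausdorffDist_of_mem hp
        (Metric.hausdorffEDist_ne_top_of_nonempty_of_bounded K.nonempty L.nonempty
          K.isCompact.isBounded L.isCompact.isBounded)
  have hC : ContractingWith (1 / 2) F := by
    refine ⟨by norm_num [← NNReal.coe_lt_coe], LipschitzWith.of_dist_le_mul fun K L => ?_⟩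
    have e : ((1 / 2 : NNReal) : ℝ) = 1 / 2 := by norm_num
    rw [e]
    refine Metric.hausdorffDist_le_of_mem_dist (by positivity) (hmem K L) fun x hx => ?_
    rw [dist_comm K L]
    exact hmem L K x hx
  have : Nonempty (TopologicalSpace.NonemptyCompacts (ℝ × ℝ)) := ⟨{(0, 0)}⟩
  have hfix := hC.fixedPoint_isFixedPt
  refine ⟨((hC.fixedPoint : TopologicalSpace.NonemptyCompacts (ℝ × ℝ)) : Set (ℝ × ℝ)),
    ⟨TopologicalSpace.NonemptyCompacts.nonempty _,
      TopologicalSpace.NonemptyCompacts.isCompact _, ?_⟩, ?_⟩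
  · rw [← hF, hfix]
  · rintro T ⟨hne, hcomp, heq⟩
    have : Function.IsFixedPt F ⟨⟨T, hcomp⟩, hne⟩ :=
      TopologicalSpace.NonemptyCompacts.ext heq.symm
    exact congrArg (fun K : TopologicalSpace.NonemptyCompacts (ℝ × ℝ) => (K : Set (ℝ × ℝ)))
      (hC.fixedPoint_unique this)

/-- `ψ_i = ψ_{i₁} ∘ ⋯ ∘ ψ_{iₙ}` for a finite word `i = (i₁, …, iₙ)`. -/
noncomputable def psiWord (c : ℝ) : List (Fin 3) → ℝ × ℝ → ℝ × ℝ
  | [] => id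
  | a :: i => psi c a ∘ psiWord c i

/-- `Vⁿ`, the union of `ψ_i(V⁰)` over the words `i` of length `n`, where
`V⁰ = {(0, 0), (1, 0)}`. -/
noncomputable def vertexSet (c : ℝ) (n : ℕ) : Set (ℝ × ℝ) :=
  ⋃ i : Fin n → Fin 3, psiWord c (List.ofFn i) '' {(0, 0), (1, 0)}

/-- `V* = ⋃ₙ Vⁿ`. -/
noncomputable def vertexSetStar (c : ℝ) : Set (ℝ × ℝ) :=
  ⋃ n : ℕ, vertexSet c n

/-! ## Multiplicative cascades -/

/-- `(w(i))`, indexed by the non-empty finite words over `{1, 2, 3}`, is a multiplicative cascade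
of random variables under `P`: the values lie in `[0, 1]`, and the triples `(w(ij))_{j ∈ S}`, for
`i` a finite word (possibly empty), are independent copies of `(w(j))_{j ∈ S}`. The value at the
empty word plays no role. -/
structure IsMultiplicativeCascade {Ω : Type*} [MeasurableSpace Ω] (P : Measure Ω)
    (w : List (Fin 3) → Ω → ℝ) : Prop where
  measurable : ∀ i, i ≠ [] → Measurable (w i)
  mem_Icc : ∀ i, i ≠ [] → ∀ᵐ ω ∂P, w i ω ∈ Set.Icc (0 : ℝ) 1
  indep : iIndepFun (fun (i : List (Fin 3)) (ω : Ω) (j : Fin 3) => w (i ++ [j]) ω) P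
  identDistrib : ∀ i : List (Fin 3),
    IdentDistrib (fun (ω : Ω) (j : Fin 3) => w (i ++ [j]) ω)
      (fun (ω : Ω) (j : Fin 3) => w [j] ω) P P

/-! The next definitions concern one realisation `w : List (Fin 3) → ℝ` of the cascade. -/

/-- `l(i) = w(i|1) w(i|2) ⋯ w(i)`, and `l(∅) = 1`. -/
noncomputable def cascadeLength (w : List (Fin 3) → ℝ) (i : List (Fin 3)) : ℝ :=
  ∏ k ∈ Finset.range i.length, w (i.take (k + 1))

/-- The resistance perturbation `R_i = lim_{n → ∞} ∑_{j ∈ {1,2}ⁿ} l(ij) / l(i)`. -/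
noncomputable def resistancePerturbation (w : List (Fin 3) → ℝ) (i : List (Fin 3)) : ℝ :=
  limUnder atTop fun n : ℕ => ∑ j : Fin n → Fin 2,
    cascadeLength w (i ++ List.ofFn fun k => (j k).castSucc) / cascadeLength w i

/-- The Dirichlet form `𝓔ⁿ(f, f) = ∑_{i ∈ Σₙ} D(f ∘ ψ_i, f ∘ ψ_i) / (l(i) R_i)`, where
`D(f, f) = (f(0, 0) - f(1, 0))²`. It only depends on the restriction of `f` to `Vⁿ`. -/
noncomputable def energy (c : ℝ) (w : List (Fin 3) → ℝ) (n : ℕ) (f : ℝ × ℝ → ℝ) : ℝ :=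
  ∑ i : Fin n → Fin 3,
    1 / (cascadeLength w (List.ofFn i) * resistancePerturbation w (List.ofFn i)) *
      (f (psiWord c (List.ofFn i) (0, 0)) - f (psiWord c (List.ofFn i) (1, 0))) ^ 2

open Classical in
/-- The resistance metric `R*` on `V*`: `R*(x, x) = 0` and, for `x ≠ y`,
`R*(x, y)⁻¹ = inf {𝓔*(f, f) : f ∈ 𝓕*, f(x) = 0, f(y) = 1}`, where `𝓔*(f, f) = limₙ 𝓔ⁿ(f, f)` and
`𝓕*` is the set of the functions for which this limit exists finitely. A function on `V*` is
represented by its extensions to the plane, on which `𝓔*` does not depend. -/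
noncomputable def resistanceStar (c : ℝ) (w : List (Fin 3) → ℝ) (x y : ℝ × ℝ) : ℝ :=
  if x = y then 0
  else (sInf {e : ℝ | ∃ f : ℝ × ℝ → ℝ, f x = 0 ∧ f y = 1 ∧
    Tendsto (fun n => energy c w n f) atTop (𝓝 e)})⁻¹

/-- `R` is the extension of `R*` to `T`: `R(x, y) = limₙ R*(xₙ, yₙ)`, the limit existing for all
sequences `(xₙ)`, `(yₙ)` in `V*` that converge to `x`, `y` in the topology of the plane. -/
def IsResistanceExtension (c : ℝ) (w : List (Fin 3) → ℝ) {T : Set (ℝ × ℝ)}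
    (R : T → T → ℝ) : Prop :=
  ∀ (x y : T) (u v : ℕ → ℝ × ℝ), (∀ n, u n ∈ vertexSetStar c) → (∀ n, v n ∈ vertexSetStar c) →
    Tendsto u atTop (𝓝 (x : ℝ × ℝ)) → Tendsto v atTop (𝓝 (y : ℝ × ℝ)) →
    Tendsto (fun n => resistanceStar c w (u n) (v n)) atTop (𝓝 (R x y))

/-!
The edges of level `n` of the dendrite form a tree: cells of the same level meet in common vertices
only (`IsSelfSimilarDendrite.eq_end_of_psiWord_eq`), which holds because the three contractions map
a rhombus with corners `(0, 0)` and `(1, 0)` into itself and, as `2 * c < 1`, the three images of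
the rhombus meet in one point only. The edge of the word `i` has resistance `l(i) R_i`, and the
resistance of an edge is the sum of the resistances of its two halves. Hence the energies of a
function increase with the level, and the effective resistance between two vertices is the length
of the path that joins them. It is used in the dual form `resistanceStar_spec`: the resistance
`R*(x, y)` is the largest value of `f x - f y` among the functions `f` that change along each edge
by at most its resistance. The triangle inequality is then immediate.

A function of this kind oscillates on the cell of `i` by at most a constant times the sum over `k`
of the largest resistance of an edge `k` levels below `i`. Suppose that for `β > α` arbitrarily
close to `α` the sums of `(l(i) R_i) ^ β` over the words of length `n` decay geometrically in `n`.
Then the sums of the `β`-th powers of the diameters of the cells of level `n` tend to `0`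
(`exists_cell_bound`). Consequently `R*` is uniformly small on small neighbourhoods and extends to
the dendrite, the extension is a metric (`exists_nhds_le_resistanceStar`: a path between distant
cells passes a whole edge of their level), and the cells provide coverings that bound the Hausdorff
dimension by `α`; see `exists_metricSpace_of_decay`.

The geometric decay holds almost surely. The law of the cascade is a product measure on the
environments, under which the triple at the root and the three subenvironments are independent and
the latter are copies of the whole (`measurePreserving_glueEnv`). All facts about the masses
`Z_n = ∑ l(j)`, `j` of length `n` in the first two letters, follow from the recursion
`Z_{n+1} = w(1) Z_n' + w(2) Z_n''`: the increments decay geometrically in `L²`, so that `Z_n`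
converges to a limit `R` that is not almost surely `0`; the event `R = 0` has probability `q` with
`q = q ^ 2`, so that `R > 0` almost surely; and all integer moments of `Z_n` are bounded, so that
`R` has finite moments of all orders. Finally, the mean of the sum of `(l(i) R_i) ^ β` over the
words of length `n` is `λ ^ n E(R ^ β)` with `λ = E(∑ w(a) ^ β) < 1`.
-/

/-! ### Finite words -/

/-- The finite set of words of length `n`. -/
def words (n : ℕ) : Finset (List (Fin 3)) :=
  Finset.univ.image fun i : Fin n → Fin 3 => List.ofFn i

theorem mem_words {n : ℕ} {i : List (Fin 3)} : i ∈ words n ↔ i.length = n := by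
  constructor
  · intro h
    obtain ⟨f, -, rfl⟩ := Finset.mem_image.1 h
    simp
  · rintro rfl
    exact Finset.mem_image.2 ⟨i.get, Finset.mem_univ _, List.ofFn_get i⟩

theorem sum_ofFn_eq_sum_words {M : Type*} [AddCommMonoid M] (n : ℕ) (F : List (Fin 3) → M) :
    ∑ i : Fin n → Fin 3, F (List.ofFn i) = ∑ i ∈ words n, F i :=
  (Finset.sum_image fun _ _ _ _ h => List.ofFn_injective h).symm

theorem words_zero : words 0 = {[]} := by
  ext i
  simp [mem_words]

theorem sum_words_zero {M : Type*} [AddCommMonoid M] (F : List (Fin 3) → M) :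
    ∑ i ∈ words 0, F i = F [] := by
  simp [words_zero]

theorem sum_words_succ {M : Type*} [AddCommMonoid M] (n : ℕ) (F : List (Fin 3) → M) :
    ∑ i ∈ words (n + 1), F i = ∑ a : Fin 3, ∑ i ∈ words n, F (a :: i) := by
  simp_rw [← sum_ofFn_eq_sum_words]
  rw [← (Fin.consEquiv fun _ : Fin (n + 1) => Fin 3).sum_comp, Fintype.sum_prod_type]
  simp [Fin.consEquiv, List.ofFn_succ]

theorem sum_words_add {M : Type*} [AddCommMonoid M] (n k : ℕ) (F : List (Fin 3) → M) :
    ∑ i ∈ words (n + k), F i = ∑ i ∈ words n, ∑ j ∈ words k, F (i ++ j) := by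
  induction n generalizing F with
  | zero => simp [words_zero]
  | succ n ih =>
    rw [Nat.add_right_comm, sum_words_succ, sum_words_succ]
    exact Finset.sum_congr rfl fun a _ => ih _

theorem sum_words_succ' {M : Type*} [AddCommMonoid M] (n : ℕ) (F : List (Fin 3) → M) :
    ∑ i ∈ words (n + 1), F i = ∑ i ∈ words n, ∑ a : Fin 3, F (i ++ [a]) := by
  rw [sum_words_add]
  refine Finset.sum_congr rfl fun i _ => ?_
  rw [sum_words_succ]
  simp [words_zero]

/-! ### Geometry of the planar dendrite -/

theorem psiWord_append (c : ℝ) (i j : List (Fin 3)) (z : ℝ × ℝ) :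
    psiWord c (i ++ j) z = psiWord c i (psiWord c j z) := by
  induction i with
  | nil => rfl
  | cons a i ih => exact congrArg (psi c a) ih

theorem psiWord_cons (c : ℝ) (a : Fin 3) (i : List (Fin 3)) (z : ℝ × ℝ) :
    psiWord c (a :: i) z = psi c a (psiWord c i z) := rfl

theorem psiWord_singleton (c : ℝ) (a : Fin 3) (z : ℝ × ℝ) :
    psiWord c [a] z = psi c a z := rfl

theorem psi_zero_apply (c : ℝ) (p : ℝ × ℝ) : psi c 0 p = ((1 - p.1) / 2, p.2 / 2) := rfl

theorem psi_one_apply (c : ℝ) (p : ℝ × ℝ) : psi c 1 p = ((1 + p.1) / 2, -p.2 / 2) := rfl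

theorem psi_two_apply (c : ℝ) (p : ℝ × ℝ) : psi c 2 p = (1 / 2 + c * p.2, c * p.1) := rfl

/-- All three maps send `(0, 0)` to the midpoint of the segment between `(0, 0)` and `(1, 0)`. -/
theorem psi_origin (c : ℝ) (a : Fin 3) : psi c a (0, 0) = (1 / 2, 0) := by
  fin_cases a <;> simp [psi]

theorem psi_zero_one (c : ℝ) : psi c 0 (1, 0) = (0, 0) := by simp [psi]

theorem psi_one_one (c : ℝ) : psi c 1 (1, 0) = (1, 0) := by
  rw [psi_one_apply]
  norm_num

theorem psi_injective {c : ℝ} (h0 : 0 < c) (a : Fin 3) : Function.Injective (psi c a) := by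
  intro p q h
  fin_cases a
  · simp only [Fin.zero_eta, psi_zero_apply, Prod.mk.injEq] at h
    ext <;> linarith
  · simp only [Fin.mk_one, psi_one_apply, Prod.mk.injEq] at h
    ext <;> linarith
  · simp only [Fin.reduceFinMk, psi_two_apply, Prod.mk.injEq, add_right_inj,
      mul_right_inj' h0.ne'] at h
    ext <;> linarith

theorem psiWord_injective {c : ℝ} (h0 : 0 < c) (i : List (Fin 3)) :
    Function.Injective (psiWord c i) := by
  induction i with
  | nil => exact fun _ _ h => h
  | cons a i ih => exact (psi_injective h0 a).comp ih

theorem psiWord_dist_le {c : ℝ} (h0 : 0 < c) (h1 : c < 1 / 2) (i : List (Fin 3)) (p q : ℝ × ℝ) :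
    dist (psiWord c i p) (psiWord c i q) ≤ (1 / 2) ^ i.length * dist p q := by
  induction i with
  | nil => simp [psiWord]
  | cons a i ih =>
    have := (psi_lipschitz h0 h1 a).dist_le_mul (psiWord c i p) (psiWord c i q)
    rw [psiWord_cons, psiWord_cons, List.length_cons, pow_succ']
    have e : ((1 / 2 : NNReal) : ℝ) = 1 / 2 := by norm_num
    rw [e] at this
    linarith

theorem continuous_psiWord {c : ℝ} (h0 : 0 < c) (h1 : c < 1 / 2) (i : List (Fin 3)) :
    Continuous (psiWord c i) := by
  induction i with
  | nil => exact continuous_id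
  | cons a i ih => exact (psi_lipschitz h0 h1 a).continuous.comp ih

theorem psi_infDist_le {c : ℝ} (h0 : 0 < c) (h1 : c < 1 / 2) (a : Fin 3) {A : Set (ℝ × ℝ)}
    (hA : A.Nonempty) (hinv : Set.MapsTo (psi c a) A A) (p : ℝ × ℝ) :
    Metric.infDist (psi c a p) A ≤ 1 / 2 * Metric.infDist p A := by
  have : ∀ q ∈ A, 2 * Metric.infDist (psi c a p) A ≤ dist p q := by
    intro q hq
    have h := (psi_lipschitz h0 h1 a).dist_le_mul p q
    have e : ((1 / 2 : NNReal) : ℝ) = 1 / 2 := by norm_num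
    rw [e] at h
    have := Metric.infDist_le_dist_of_mem (x := psi c a p) (hinv hq)
    linarith
  have := (Metric.le_infDist hA).2 fun {q} hq => this q hq
  linarith

/-- A closed rhombus with opposite corners `(0, 0)` and `(1, 0)`, mapped into itself by the three
contractions. Since `2 * c < 1` its images meet in the midpoint only. -/
def rhombus (c : ℝ) : Set (ℝ × ℝ) := {p | |p.2| ≤ 2 * c * p.1 ∧ |p.2| ≤ 2 * c * (1 - p.1)}

theorem isClosed_rhombus (c : ℝ) : IsClosed (rhombus c) := by
  have h1 : IsClosed {p : ℝ × ℝ | |p.2| ≤ 2 * c * p.1} := isClosed_le (by fun_prop) (by fun_prop)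
  have h2 : IsClosed {p : ℝ × ℝ | |p.2| ≤ 2 * c * (1 - p.1)} :=
    isClosed_le (by fun_prop) (by fun_prop)
  exact h1.inter h2

theorem psi_mapsTo_rhombus {c : ℝ} (h0 : 0 < c) (h1 : c < 1 / 2) (a : Fin 3) :
    Set.MapsTo (psi c a) (rhombus c) (rhombus c) := by
  rintro ⟨x, y⟩ ⟨hp, hq⟩
  simp only at hp hq
  have hx : 0 ≤ x := by
    have := (abs_nonneg y).trans hp
    exact nonneg_of_mul_nonneg_right this (by positivity)
  have hx' : 0 ≤ 1 - x := by
    have := (abs_nonneg y).trans hq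
    exact nonneg_of_mul_nonneg_right this (by positivity)
  obtain ⟨hp1, hp2⟩ := abs_le.1 hp
  obtain ⟨hq1, hq2⟩ := abs_le.1 hq
  have hcx : 0 ≤ c * x := by positivity
  have hcx' : 0 ≤ c * (1 - x) := by positivity
  fin_cases a
  · simp only [Fin.zero_eta, psi_zero_apply, rhombus, Set.mem_ofPred_eq, abs_le]
    refine ⟨⟨?_, ?_⟩, ?_, ?_⟩ <;> linarith
  · simp only [Fin.mk_one, psi_one_apply, rhombus, Set.mem_ofPred_eq, abs_le]
    refine ⟨⟨?_, ?_⟩, ?_, ?_⟩ <;> linarith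
  · have hy1 : -(1 - x) ≤ y := by nlinarith
    have hy2 : y ≤ 1 - x := by nlinarith
    have hcy1 : 2 * c * (c * -(1 - x)) ≤ 2 * c * (c * y) := by gcongr
    have hcy2 : 2 * c * (c * y) ≤ 2 * c * (c * (1 - x)) := by gcongr
    have h3 : 2 * c * (c * (1 - x)) ≤ 1 * (c * (1 - x)) :=
      mul_le_mul_of_nonneg_right (by linarith) hcx'
    simp only [Fin.reduceFinMk, psi_two_apply, rhombus, Set.mem_ofPred_eq, abs_le]
    refine ⟨⟨?_, ?_⟩, ?_, ?_⟩ <;> nlinarith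

/-- The images of the rhombus under two distinct contractions meet in the image of `(0, 0)` only. -/
theorem eq_origin_of_psi_eq {c : ℝ} (h0 : 0 < c) (h1 : c < 1 / 2) {a b : Fin 3} (hab : a ≠ b)
    {p q : ℝ × ℝ} (hp : p ∈ rhombus c) (hq : q ∈ rhombus c) (h : psi c a p = psi c b q) :
    p = (0, 0) ∧ q = (0, 0) := by
  wlog hlt : a < b generalizing a b p q
  · exact (this hab.symm hq hp h.symm (lt_of_le_of_ne (not_lt.1 hlt) hab.symm)).symm
  obtain ⟨x, y⟩ := p
  obtain ⟨x', y'⟩ := q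
  obtain ⟨hp, -⟩ := hp
  obtain ⟨hq, -⟩ := hq
  simp only [abs_le] at hp hq
  obtain ⟨hp1, hp2⟩ := hp
  obtain ⟨hq1, hq2⟩ := hq
  have hx : 0 ≤ x := by
    have : 0 ≤ 2 * c * x := by linarith
    exact nonneg_of_mul_nonneg_right this (by positivity)
  have hx' : 0 ≤ x' := by
    have : 0 ≤ 2 * c * x' := by linarith
    exact nonneg_of_mul_nonneg_right this (by positivity)
  -- the wedges of slope `2 * c < 1` at the midpoint, along one half of the segment and along the
  -- dangling part, which is perpendicular to it
  have aux : ∀ x y x' y' : ℝ, 0 ≤ x → 0 ≤ x' → y ≤ 2 * c * x → -y' ≤ 2 * c * x' →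
      x = -2 * c * y' → y = 2 * c * x' → x = 0 ∧ x' = 0 := by
    intro x y x' y' hx hx' hy hy' e1 e2
    have h4 : 2 * c * x' ≤ 2 * c * (2 * c * (2 * c * x')) := by
      calc 2 * c * x' = y := e2.symm
        _ ≤ 2 * c * x := hy
        _ = 2 * c * (2 * c * -y') := by rw [e1]; ring
        _ ≤ _ := by gcongr
    have h5 : x' ≤ (2 * c * (2 * c)) * x' := by
      have := le_of_mul_le_mul_left h4 (by positivity)
      linarith
    have h6 : 2 * c * (2 * c) < 1 := by nlinarith
    have hx0 : x' = 0 := by nlinarith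
    subst hx0
    refine ⟨?_, rfl⟩
    have : -(2 * c * y') ≤ 0 := by
      have : 2 * c * -y' ≤ 2 * c * (2 * c * 0) := by gcongr
      linarith
    linarith
  fin_cases a <;> fin_cases b <;> first | exact absurd hlt (by decide) | skip
  · simp only [Fin.zero_eta, Fin.mk_one, psi_zero_apply, psi_one_apply, Prod.mk.injEq] at h
    have h5 : x = 0 := by linarith
    have h6 : x' = 0 := by linarith
    subst h5 h6
    simp only [mul_zero, neg_zero] at *
    exact ⟨Prod.ext rfl (le_antisymm hp2 hp1), Prod.ext rfl (le_antisymm hq2 hq1)⟩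
  · simp only [Fin.zero_eta, Fin.reduceFinMk, psi_zero_apply, psi_two_apply, Prod.mk.injEq] at h
    obtain ⟨h5, h6⟩ := aux x y x' y' hx hx' hp2 (by linarith) (by linarith) (by linarith)
    subst h5 h6
    simp only [mul_zero, neg_zero] at *
    exact ⟨Prod.ext rfl (le_antisymm hp2 hp1), Prod.ext rfl (le_antisymm hq2 hq1)⟩
  · simp only [Fin.mk_one, Fin.reduceFinMk, psi_one_apply, psi_two_apply, Prod.mk.injEq] at h
    obtain ⟨h5, h6⟩ := aux x (-y) x' (-y') hx hx' (by linarith) (by linarith) (by linarith)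
      (by linarith)
    subst h5 h6
    simp only [mul_zero, neg_zero] at *
    exact ⟨Prod.ext rfl (le_antisymm hp2 hp1), Prod.ext rfl (le_antisymm hq2 hq1)⟩

namespace IsSelfSimilarDendrite

variable {c : ℝ} {T : Set (ℝ × ℝ)}

theorem psi_mem (hT : IsSelfSimilarDendrite c T) (a : Fin 3) {p : ℝ × ℝ} (hp : p ∈ T) :
    psi c a p ∈ T := by
  rw [hT.2.2]
  exact Set.mem_iUnion.2 ⟨a, p, hp, rfl⟩

theorem exists_psi_eq (hT : IsSelfSimilarDendrite c T) {p : ℝ × ℝ} (hp : p ∈ T) :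
    ∃ a, ∃ q ∈ T, psi c a q = p := by
  rw [hT.2.2] at hp
  exact Set.mem_iUnion.1 hp

theorem psiWord_mem (hT : IsSelfSimilarDendrite c T) (i : List (Fin 3)) {p : ℝ × ℝ}
    (hp : p ∈ T) : psiWord c i p ∈ T := by
  induction i with
  | nil => exact hp
  | cons a i ih => exact hT.psi_mem a ih

theorem exists_psiWord_eq (hT : IsSelfSimilarDendrite c T) (n : ℕ) {p : ℝ × ℝ} (hp : p ∈ T) :
    ∃ i ∈ words n, ∃ q ∈ T, psiWord c i q = p := by
  induction n generalizing p with
  | zero => exact ⟨[], by simp [words_zero], p, hp, rfl⟩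
  | succ n ih =>
    obtain ⟨a, q, hq, rfl⟩ := hT.exists_psi_eq hp
    obtain ⟨i, hi, q', hq', rfl⟩ := ih hq
    exact ⟨a :: i, mem_words.2 (by simp [mem_words.1 hi]), q', hq', rfl⟩

theorem subset_rhombus (hT : IsSelfSimilarDendrite c T) (h0 : 0 < c) (h1 : c < 1 / 2) :
    T ⊆ rhombus c := by
  have hne : (rhombus c).Nonempty := ⟨(0, 0), by simp [rhombus, h0.le]⟩
  obtain ⟨p, hp, hmax⟩ := hT.2.1.exists_isMaxOn hT.1
    (Metric.continuous_infDist_pt (rhombus c)).continuousOn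
  obtain ⟨a, q, hq, rfl⟩ := hT.exists_psi_eq hp
  have h2 := psi_infDist_le h0 h1 a hne (psi_mapsTo_rhombus h0 h1 a) q
  have h3 : Metric.infDist q (rhombus c) ≤ Metric.infDist (psi c a q) (rhombus c) := hmax hq
  intro x hx
  have h4 : Metric.infDist x (rhombus c) ≤ Metric.infDist (psi c a q) (rhombus c) := hmax hx
  have h5 := Metric.infDist_nonneg (x := x) (s := rhombus c)
  exact ((isClosed_rhombus c).mem_iff_infDist_zero hne).2 (by linarith)

theorem one_mem (hT : IsSelfSimilarDendrite c T) (h0 : 0 < c) (h1 : c < 1 / 2) :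
    ((1, 0) : ℝ × ℝ) ∈ T := by
  have h2 := psi_infDist_le h0 h1 1 hT.1 (fun p hp => hT.psi_mem 1 hp) (1, 0)
  rw [psi_one_one] at h2
  have h5 := Metric.infDist_nonneg (x := ((1, 0) : ℝ × ℝ)) (s := T)
  exact (hT.2.1.isClosed.mem_iff_infDist_zero hT.1).2 (by linarith)

theorem zero_mem (hT : IsSelfSimilarDendrite c T) (h0 : 0 < c) (h1 : c < 1 / 2) :
    ((0, 0) : ℝ × ℝ) ∈ T := by
  rw [← psi_zero_one c]
  exact hT.psi_mem 0 (hT.one_mem h0 h1)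

theorem eq_origin (hT : IsSelfSimilarDendrite c T) (h0 : 0 < c) (h1 : c < 1 / 2) {a b : Fin 3}
    (hab : a ≠ b) {p q : ℝ × ℝ} (hp : p ∈ T) (hq : q ∈ T) (h : psi c a p = psi c b q) :
    p = (0, 0) ∧ q = (0, 0) :=
  eq_origin_of_psi_eq h0 h1 hab (hT.subset_rhombus h0 h1 hp) (hT.subset_rhombus h0 h1 hq) h

/-- The end point `(1, 0)` lies in no cell of the first level but the second one. -/
theorem eq_one_of_psi_eq_one (hT : IsSelfSimilarDendrite c T) (h0 : 0 < c) (h1 : c < 1 / 2)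
    {a : Fin 3} {p : ℝ × ℝ} (hp : p ∈ T) (h : psi c a p = (1, 0)) : a = 1 ∧ p = (1, 0) := by
  by_cases ha : a = 1
  · subst ha
    exact ⟨rfl, psi_injective h0 1 (h.trans (psi_one_one c).symm)⟩
  · have := (hT.eq_origin h0 h1 ha hp (hT.one_mem h0 h1) (h.trans (psi_one_one c).symm)).2
    simp at this

/-- The end point `(0, 0)` lies in no cell of the first level but the first one. -/
theorem eq_zero_of_psi_eq_zero (hT : IsSelfSimilarDendrite c T) (h0 : 0 < c) (h1 : c < 1 / 2)
    {a : Fin 3} {p : ℝ × ℝ} (hp : p ∈ T) (h : psi c a p = (0, 0)) : a = 0 ∧ p = (1, 0) := by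
  by_cases ha : a = 0
  · subst ha
    exact ⟨rfl, psi_injective h0 0 (h.trans (psi_zero_one c).symm)⟩
  · have := (hT.eq_origin h0 h1 ha hp (hT.one_mem h0 h1) (h.trans (psi_zero_one c).symm)).2
    simp at this

theorem eq_one_of_psiWord_eq_one (hT : IsSelfSimilarDendrite c T) (h0 : 0 < c) (h1 : c < 1 / 2)
    (i : List (Fin 3)) {p : ℝ × ℝ} (hp : p ∈ T) (h : psiWord c i p = (1, 0)) : p = (1, 0) := by
  induction i with
  | nil => exact h
  | cons a i ih => exact ih (hT.eq_one_of_psi_eq_one h0 h1 (hT.psiWord_mem i hp) h).2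

theorem eq_end_of_psiWord_eq_zero (hT : IsSelfSimilarDendrite c T) (h0 : 0 < c) (h1 : c < 1 / 2)
    (i : List (Fin 3)) {p : ℝ × ℝ} (hp : p ∈ T) (h : psiWord c i p = (0, 0)) :
    p = (0, 0) ∨ p = (1, 0) := by
  cases i with
  | nil => exact Or.inl h
  | cons a i =>
    exact Or.inr (hT.eq_one_of_psiWord_eq_one h0 h1 i hp
      (hT.eq_zero_of_psi_eq_zero h0 h1 (hT.psiWord_mem i hp) h).2)

/-- Two distinct cells of the same level meet in common vertices only. -/
theorem eq_end_of_psiWord_eq (hT : IsSelfSimilarDendrite c T) (h0 : 0 < c) (h1 : c < 1 / 2)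
    {i j : List (Fin 3)} (hlen : i.length = j.length) (hij : i ≠ j) {p q : ℝ × ℝ}
    (hp : p ∈ T) (hq : q ∈ T) (h : psiWord c i p = psiWord c j q) :
    p = (0, 0) ∨ p = (1, 0) := by
  induction i generalizing j with
  | nil => exact absurd (List.length_eq_zero_iff.1 hlen.symm).symm hij
  | cons a i ih =>
    cases j with
    | nil => simp at hlen
    | cons b j =>
      by_cases hab : a = b
      · subst hab
        exact ih (by simpa using hlen) (fun e => hij (by rw [e])) (psi_injective h0 a h)
      · have := (hT.eq_origin h0 h1 hab (hT.psiWord_mem i hp) (hT.psiWord_mem j hq) h).1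
        exact hT.eq_end_of_psiWord_eq_zero h0 h1 i hp this

end IsSelfSimilarDendrite

/-! ### Vertices -/

theorem mem_vertexSet {c : ℝ} {n : ℕ} {x : ℝ × ℝ} :
    x ∈ vertexSet c n ↔ ∃ i ∈ words n, x = psiWord c i (0, 0) ∨ x = psiWord c i (1, 0) := by
  simp only [vertexSet, Set.mem_iUnion, Set.image_insert_eq, Set.image_singleton,
    Set.mem_insert_iff, Set.mem_singleton_iff, words, Finset.mem_image, Finset.mem_univ, true_and,
    exists_exists_eq_and]

theorem psiWord_mem_vertexSet {c : ℝ} {n : ℕ} {i : List (Fin 3)} (hi : i ∈ words n)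
    {e : ℝ × ℝ} (he : e = (0, 0) ∨ e = (1, 0)) : psiWord c i e ∈ vertexSet c n :=
  mem_vertexSet.2 ⟨i, hi, by rcases he with rfl | rfl <;> simp⟩

theorem mem_vertexSet_succ {c : ℝ} {n : ℕ} {x : ℝ × ℝ} :
    x ∈ vertexSet c (n + 1) ↔ ∃ a, ∃ y ∈ vertexSet c n, x = psi c a y := by
  constructor
  · intro h
    obtain ⟨i, hi, h⟩ := mem_vertexSet.1 h
    cases i with
    | nil => simp [mem_words] at hi
    | cons a i =>
      have hi' : i ∈ words n := by simpa [mem_words] using hi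
      rcases h with rfl | rfl
      · exact ⟨a, _, psiWord_mem_vertexSet hi' (Or.inl rfl), rfl⟩
      · exact ⟨a, _, psiWord_mem_vertexSet hi' (Or.inr rfl), rfl⟩
  · rintro ⟨a, y, hy, rfl⟩
    obtain ⟨i, hi, h⟩ := mem_vertexSet.1 hy
    have hi' : a :: i ∈ words (n + 1) := by simpa [mem_words] using hi
    rcases h with rfl | rfl
    · exact psiWord_mem_vertexSet hi' (Or.inl rfl)
    · exact psiWord_mem_vertexSet hi' (Or.inr rfl)

theorem vertexSet_subset_succ (c : ℝ) (n : ℕ) : vertexSet c n ⊆ vertexSet c (n + 1) := by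
  induction n with
  | zero =>
    intro x hx
    obtain ⟨i, hi, h⟩ := mem_vertexSet.1 hx
    rw [mem_words, List.length_eq_zero_iff] at hi
    subst hi
    have key : ((1, 0) : ℝ × ℝ) ∈ vertexSet c 0 :=
      psiWord_mem_vertexSet (i := []) (by simp [mem_words]) (Or.inr rfl)
    rcases h with rfl | rfl
    · exact mem_vertexSet_succ.2 ⟨0, _, key, (psi_zero_one c).symm⟩
    · exact mem_vertexSet_succ.2 ⟨1, _, key, (psi_one_one c).symm⟩
  | succ n ih =>
    intro x hx
    obtain ⟨a, y, hy, rfl⟩ := mem_vertexSet_succ.1 hx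
    exact mem_vertexSet_succ.2 ⟨a, y, ih hy, rfl⟩

theorem vertexSet_mono (c : ℝ) : Monotone (vertexSet c) :=
  monotone_nat_of_le_succ (vertexSet_subset_succ c)

theorem mem_vertexSetStar {c : ℝ} {x : ℝ × ℝ} :
    x ∈ vertexSetStar c ↔ ∃ n, x ∈ vertexSet c n := Set.mem_iUnion

theorem psiWord_mem_vertexSetStar {c : ℝ} (i : List (Fin 3)) {x : ℝ × ℝ}
    (hx : x ∈ vertexSetStar c) : psiWord c i x ∈ vertexSetStar c := by
  obtain ⟨n, hn⟩ := mem_vertexSetStar.1 hx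
  obtain ⟨j, hj, h⟩ := mem_vertexSet.1 hn
  refine mem_vertexSetStar.2 ⟨i.length + n, ?_⟩
  have hij : i ++ j ∈ words (i.length + n) := by simp [mem_words, mem_words.1 hj]
  rcases h with rfl | rfl <;> rw [← psiWord_append]
  · exact psiWord_mem_vertexSet hij (Or.inl rfl)
  · exact psiWord_mem_vertexSet hij (Or.inr rfl)

theorem end_mem_vertexSetStar (c : ℝ) {e : ℝ × ℝ} (he : e = (0, 0) ∨ e = (1, 0)) :
    e ∈ vertexSetStar c :=
  mem_vertexSetStar.2 ⟨0, psiWord_mem_vertexSet (i := []) (by simp [mem_words]) he⟩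

namespace IsSelfSimilarDendrite

variable {c : ℝ} {T : Set (ℝ × ℝ)}

theorem end_mem (hT : IsSelfSimilarDendrite c T) (h0 : 0 < c) (h1 : c < 1 / 2) {e : ℝ × ℝ}
    (he : e = (0, 0) ∨ e = (1, 0)) : e ∈ T := by
  rcases he with rfl | rfl
  exacts [hT.zero_mem h0 h1, hT.one_mem h0 h1]

theorem vertexSetStar_subset (hT : IsSelfSimilarDendrite c T) (h0 : 0 < c) (h1 : c < 1 / 2) :
    vertexSetStar c ⊆ T := by
  intro x hx
  obtain ⟨n, hn⟩ := mem_vertexSetStar.1 hx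
  obtain ⟨i, -, rfl | rfl⟩ := mem_vertexSet.1 hn
  · exact hT.psiWord_mem i (hT.zero_mem h0 h1)
  · exact hT.psiWord_mem i (hT.one_mem h0 h1)

/-- A vertex of the dendrite that lies in the cell of `i` is a vertex of that cell. -/
theorem mem_image_vertexSetStar (hT : IsSelfSimilarDendrite c T) (h0 : 0 < c) (h1 : c < 1 / 2)
    {i : List (Fin 3)} {p : ℝ × ℝ} (hp : p ∈ T) (h : psiWord c i p ∈ vertexSetStar c) :
    p ∈ vertexSetStar c := by
  obtain ⟨n, hn⟩ := mem_vertexSetStar.1 h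
  obtain ⟨k, hk, hx⟩ := mem_vertexSet.1 (vertexSet_mono c (Nat.le_add_left n i.length) hn)
  obtain ⟨e, he, hx⟩ : ∃ e : ℝ × ℝ, (e = (0, 0) ∨ e = (1, 0)) ∧
      psiWord c i p = psiWord c k e := by
    rcases hx with hx | hx
    exacts [⟨_, Or.inl rfl, hx⟩, ⟨_, Or.inr rfl, hx⟩]
  rw [mem_words] at hk
  rw [← List.take_append_drop i.length k, psiWord_append] at hx
  by_cases hik : i = k.take i.length
  · rw [← hik] at hx
    rw [psiWord_injective h0 i hx]
    exact psiWord_mem_vertexSetStar _ (end_mem_vertexSetStar c he)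
  · exact end_mem_vertexSetStar c (hT.eq_end_of_psiWord_eq h0 h1
      (by rw [List.length_take]; omega) hik hp (hT.psiWord_mem _ (hT.end_mem h0 h1 he)) hx)

/-- The vertices are dense in the dendrite. -/
theorem subset_closure_vertexSetStar (hT : IsSelfSimilarDendrite c T) (h0 : 0 < c)
    (h1 : c < 1 / 2) : T ⊆ closure (vertexSetStar c) := by
  intro x hx
  obtain ⟨D, hD⟩ := Metric.isBounded_iff.1 hT.2.1.isBounded
  refine Metric.mem_closure_iff.2 fun ε hε => ?_
  have hlim : Tendsto (fun n : ℕ => (1 / 2 : ℝ) ^ n * D) atTop (𝓝 0) := by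
    simpa using (tendsto_pow_atTop_nhds_zero_of_lt_one (r := (1 / 2 : ℝ)) (by norm_num)
      (by norm_num)).mul_const D
  obtain ⟨n, hn⟩ := (hlim.eventually (gt_mem_nhds hε)).exists
  obtain ⟨i, hi, q, hq, rfl⟩ := hT.exists_psiWord_eq n hx
  refine ⟨psiWord c i (0, 0), psiWord_mem_vertexSetStar i (end_mem_vertexSetStar c (Or.inl rfl)),
    (psiWord_dist_le h0 h1 i _ _).trans_lt (lt_of_le_of_lt ?_ hn)⟩
  rw [mem_words.1 hi]
  gcongr
  exact hD hq (hT.zero_mem h0 h1)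

/-- The cell `ψ_i(T)` of the dendrite is closed. -/
theorem isClosed_cell (hT : IsSelfSimilarDendrite c T) (h0 : 0 < c) (h1 : c < 1 / 2)
    (i : List (Fin 3)) : IsClosed (psiWord c i '' T) :=
  (hT.2.1.image (continuous_psiWord h0 h1 i)).isClosed

end IsSelfSimilarDendrite

/-! ### Functions on the tree of vertices -/

/-- The difference of `f` along the edge from `ψ_i(0, 0)` to `ψ_i(1, 0)`. -/
noncomputable def edgeDiff (c : ℝ) (f : ℝ × ℝ → ℝ) (i : List (Fin 3)) : ℝ :=
  f (psiWord c i (0, 0)) - f (psiWord c i (1, 0))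

theorem edgeDiff_append (c : ℝ) (f : ℝ × ℝ → ℝ) (i j : List (Fin 3)) :
    edgeDiff c f (i ++ j) = edgeDiff c (f ∘ psiWord c i) j := by
  simp [edgeDiff, psiWord_append]

theorem edgeDiff_cons (c : ℝ) (f : ℝ × ℝ → ℝ) (a : Fin 3) (j : List (Fin 3)) :
    edgeDiff c f (a :: j) = edgeDiff c (f ∘ psi c a) j := rfl

theorem edgeDiff_split (c : ℝ) (f : ℝ × ℝ → ℝ) (i : List (Fin 3)) :
    edgeDiff c f i = edgeDiff c f (i ++ [1]) - edgeDiff c f (i ++ [0]) := by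
  simp [edgeDiff, psiWord_append, psiWord_singleton, psi_origin, psi_zero_one, psi_one_one]

/-- Any two vertices of level `n` are joined by a path of edges of level `n`, encoded by the signs
with which its edges are passed; the edges off the path carry the sign `0`. -/
theorem exists_path {c : ℝ} (n : ℕ) {x y : ℝ × ℝ} (hx : x ∈ vertexSet c n)
    (hy : y ∈ vertexSet c n) : ∃ ε : List (Fin 3) → ℝ, (∀ i, ε i = 0 ∨ ε i = 1 ∨ ε i = -1) ∧
      ∀ f : ℝ × ℝ → ℝ, f x - f y = ∑ i ∈ words n, ε i * edgeDiff c f i := by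
  induction n generalizing x y with
  | zero =>
    obtain ⟨i, hi, hx⟩ := mem_vertexSet.1 hx
    obtain ⟨j, hj, hy⟩ := mem_vertexSet.1 hy
    rw [mem_words, List.length_eq_zero_iff] at hi hj
    subst hi hj
    simp only [sum_words_zero]
    rcases hx with rfl | rfl <;> rcases hy with rfl | rfl
    · exact ⟨fun _ => 0, by simp, by simp⟩
    · exact ⟨fun _ => 1, by simp, by simp [edgeDiff]⟩
    · exact ⟨fun _ => -1, by simp, by simp [edgeDiff]⟩
    · exact ⟨fun _ => 0, by simp, by simp⟩
  | succ n ih =>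
    obtain ⟨a, x', hx', rfl⟩ := mem_vertexSet_succ.1 hx
    obtain ⟨b, y', hy', rfl⟩ := mem_vertexSet_succ.1 hy
    by_cases hab : a = b
    · subst hab
      obtain ⟨ε, hε, hsum⟩ := ih hx' hy'
      refine ⟨fun i => if i.head? = some a then ε i.tail else 0, fun i => ?_, fun f => ?_⟩
      · dsimp only
        split_ifs
        exacts [hε _, Or.inl rfl]
      · rw [sum_words_succ, Finset.sum_eq_single a]
        · simpa [edgeDiff_cons] using hsum (f ∘ psi c a)
        · intro e _ he
          simp [he]
        · simp
    · have h0 : ((0, 0) : ℝ × ℝ) ∈ vertexSet c n := vertexSet_mono c (Nat.zero_le n)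
        (psiWord_mem_vertexSet (i := []) (by simp [mem_words]) (Or.inl rfl))
      obtain ⟨ε, hε, hsum⟩ := ih hx' h0
      obtain ⟨ε', hε', hsum'⟩ := ih h0 hy'
      refine ⟨fun i => if i.head? = some a then ε i.tail else
        if i.head? = some b then ε' i.tail else 0, fun i => ?_, fun f => ?_⟩
      · dsimp only
        split_ifs
        exacts [hε _, hε' _, Or.inl rfl]
      · have h2 := hsum (f ∘ psi c a)
        have h3 := hsum' (f ∘ psi c b)
        simp only [Function.comp_apply, psi_origin] at h2 h3
        have h4 : f (psi c a x') - f (psi c b y') =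
            (f (psi c a x') - f (1 / 2, 0)) + (f (1 / 2, 0) - f (psi c b y')) := by ring
        rw [h4, h2, h3, sum_words_succ, Finset.sum_eq_add a b hab]
        · simp [edgeDiff_cons, Ne.symm hab]
        · rintro e - ⟨he, he'⟩
          simp [he, he']
        · simp
        · simp

theorem sub_eq_sub_of_edgeDiff_eq {c : ℝ} {n : ℕ} {f g : ℝ × ℝ → ℝ}
    (h : ∀ i ∈ words n, edgeDiff c f i = edgeDiff c g i) {x y : ℝ × ℝ} (hx : x ∈ vertexSet c n)
    (hy : y ∈ vertexSet c n) : f x - f y = g x - g y := by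
  obtain ⟨ε, -, hsum⟩ := exists_path n hx hy
  rw [hsum, hsum]
  exact Finset.sum_congr rfl fun i hi => by rw [h i hi]

/-- The graph of level `n` has no cycles: the differences along its edges can be prescribed. -/
theorem exists_edgeDiff_eq {c : ℝ} {T : Set (ℝ × ℝ)} (hT : IsSelfSimilarDendrite c T)
    (h0 : 0 < c) (h1 : c < 1 / 2) (n : ℕ) (δ : List (Fin 3) → ℝ) :
    ∃ f : ℝ × ℝ → ℝ, f (0, 0) = 0 ∧ ∀ i ∈ words n, edgeDiff c f i = δ i := by
  classical
  suffices H : ∃ f : ℝ × ℝ → ℝ, ∀ i ∈ words n, edgeDiff c f i = δ i by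
    obtain ⟨f, hf⟩ := H
    refine ⟨fun z => f z - f (0, 0), by simp, fun i hi => ?_⟩
    rw [← hf i hi]
    simp [edgeDiff]
  induction n generalizing δ with
  | zero =>
    refine ⟨fun z => if z = (0, 0) then δ [] else 0, fun i hi => ?_⟩
    rw [mem_words, List.length_eq_zero_iff] at hi
    subst hi
    simp [edgeDiff, psiWord]
  | succ n ih =>
    choose g hg using fun a => ih fun i => δ (a :: i)
    -- glue solutions on the three cells, normalised to vanish at their common point
    let f : ℝ × ℝ → ℝ := fun z =>
      if h : ∃ b : Fin 3, ∃ q, q ∈ T ∧ psi c b q = z then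
        g h.choose h.choose_spec.choose - g h.choose (0, 0) else 0
    have key : ∀ (a : Fin 3) (p : ℝ × ℝ), p ∈ T → f (psi c a p) = g a p - g a (0, 0) := by
      intro a p hp
      have h : ∃ b : Fin 3, ∃ q, q ∈ T ∧ psi c b q = psi c a p := ⟨a, p, hp, rfl⟩
      obtain ⟨hq, he⟩ := h.choose_spec.choose_spec
      have hf : f (psi c a p) =
          g h.choose h.choose_spec.choose - g h.choose (0, 0) := dif_pos h
      rw [hf]
      generalize h.choose_spec.choose = q at *
      generalize h.choose = b at *
      by_cases hab : b = a
      · subst hab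
        rw [psi_injective h0 b he]
      · obtain ⟨rfl, rfl⟩ := hT.eq_origin h0 h1 hab hq hp he
        simp
    refine ⟨f, fun i hi => ?_⟩
    cases i with
    | nil => simp [mem_words] at hi
    | cons a i =>
      have hi' : i ∈ words n := by simpa [mem_words] using hi
      rw [← hg a i hi', edgeDiff, psiWord_cons, psiWord_cons,
        key a _ (hT.psiWord_mem i (hT.zero_mem h0 h1)),
        key a _ (hT.psiWord_mem i (hT.one_mem h0 h1)), edgeDiff]
      ring

/-- The differences along all edges of level at least `n` can be prescribed, provided that they
are consistent with the subdivision of the edges. -/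
theorem exists_edgeDiff_eq_of_split {c : ℝ} {T : Set (ℝ × ℝ)} (hT : IsSelfSimilarDendrite c T)
    (h0 : 0 < c) (h1 : c < 1 / 2) (n : ℕ) (δ : List (Fin 3) → ℝ)
    (hδ : ∀ i, n ≤ i.length → δ i = δ (i ++ [1]) - δ (i ++ [0])) :
    ∃ f : ℝ × ℝ → ℝ, ∀ i, n ≤ i.length → edgeDiff c f i = δ i := by
  classical
  choose F hF0 hF using fun m => exists_edgeDiff_eq hT h0 h1 m δ
  have key : ∀ d k, n ≤ k → ∀ i ∈ words k, edgeDiff c (F (k + d)) i = δ i := by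
    intro d
    induction d with
    | zero => exact fun k _ => hF k
    | succ d ih =>
      intro k hk i hi
      have hi' : ∀ a : Fin 3, i ++ [a] ∈ words (k + 1) := fun a => by
        simpa [mem_words] using hi
      rw [edgeDiff_split, hδ i (by rw [mem_words.1 hi]; exact hk)]
      rw [show k + (d + 1) = k + 1 + d by ring]
      rw [ih (k + 1) (by omega) _ (hi' 1), ih (k + 1) (by omega) _ (hi' 0)]
  have hzero : ∀ k, ((0, 0) : ℝ × ℝ) ∈ vertexSet c k := fun k =>
    vertexSet_mono c (Nat.zero_le k)
      (psiWord_mem_vertexSet (i := []) (by simp [mem_words]) (Or.inl rfl))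
  have heq : ∀ k m, n ≤ k → k ≤ m → ∀ x ∈ vertexSet c k, F m x = F k x := by
    intro k m hk hkm x hx
    obtain ⟨d, rfl⟩ := Nat.exists_eq_add_of_le hkm
    have := sub_eq_sub_of_edgeDiff_eq (c := c) (n := k) (f := F (k + d)) (g := F k)
      (fun i hi => by rw [key d k hk i hi, hF k i hi]) hx (hzero k)
    rwa [hF0, hF0, sub_zero, sub_zero] at this
  -- the functions `F m` with the given differences on level `m` agree where they overlap
  let f : ℝ × ℝ → ℝ := fun x =>
    if h : ∃ k, n ≤ k ∧ x ∈ vertexSet c k then F h.choose x else 0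
  have hf : ∀ k, n ≤ k → ∀ x ∈ vertexSet c k, f x = F k x := by
    intro k hk x hx
    have h : ∃ k, n ≤ k ∧ x ∈ vertexSet c k := ⟨k, hk, hx⟩
    have e : f x = F h.choose x := dif_pos h
    obtain ⟨h2, h3⟩ := h.choose_spec
    rw [e, ← heq _ (max k h.choose) h2 (le_max_right _ _) x h3,
      heq k (max k h.choose) hk (le_max_left _ _) x hx]
  refine ⟨f, fun i hi => ?_⟩
  have hi' : i ∈ words i.length := mem_words.2 rfl
  rw [edgeDiff, hf _ hi _ (psiWord_mem_vertexSet hi' (Or.inl rfl)),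
    hf _ hi _ (psiWord_mem_vertexSet hi' (Or.inr rfl))]
  exact hF _ i hi'

/-! ### Resistances of the edges -/

/-- A positive weight on the edges of all levels, additive under the subdivision of an edge into
its two halves; the third, dangling, edge of the subdivision is not constrained. -/
structure IsResistanceWeight (r : List (Fin 3) → ℝ) : Prop where
  pos : ∀ i, 0 < r i
  split : ∀ i, r i = r (i ++ [0]) + r (i ++ [1])

/-- `f` changes along each edge by at most the weight of the edge. -/
def IsLip (c : ℝ) (r : List (Fin 3) → ℝ) (f : ℝ × ℝ → ℝ) : Prop :=
  ∀ i, |edgeDiff c f i| ≤ r i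

theorem isLip_of_le_length {c : ℝ} {r : List (Fin 3) → ℝ} (hr : IsResistanceWeight r) (n : ℕ)
    {f : ℝ × ℝ → ℝ} (h : ∀ i, n ≤ i.length → |edgeDiff c f i| ≤ r i) : IsLip c r f := by
  induction n with
  | zero => exact fun i => h i (Nat.zero_le _)
  | succ n ih =>
    refine ih fun i hi => ?_
    have h0 := h (i ++ [0]) (by simpa using hi)
    have h1 := h (i ++ [1]) (by simpa using hi)
    have h2 := abs_sub (edgeDiff c f (i ++ [1])) (edgeDiff c f (i ++ [0]))
    rw [edgeDiff_split, hr.split]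
    linarith

/-- The slope that an affine function on an edge has on its three parts, relative to its slope on
the edge; the first half is reversed and the function is constant on the dangling part. -/
noncomputable def slopeSign (j : List (Fin 3)) : ℝ := (j.map ![-1, 1, 0]).prod

/-- Slopes `t i` prescribed on the edges of level `n` belong to a function that is affine on these
edges and constant on everything that is attached to them at finer levels. -/
theorem exists_affine {c : ℝ} {T : Set (ℝ × ℝ)} (hT : IsSelfSimilarDendrite c T)
    (h0 : 0 < c) (h1 : c < 1 / 2) {r : List (Fin 3) → ℝ} (hr : IsResistanceWeight r) (n : ℕ)
    (t : List (Fin 3) → ℝ) : ∃ f : ℝ × ℝ → ℝ,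
      (∀ i ∈ words n, edgeDiff c f i = t i * r i) ∧
      (∀ i ∈ words n, ∀ j, |edgeDiff c f (i ++ j)| ≤ |t i| * r (i ++ j)) ∧
      ∀ k, ∑ i ∈ words (n + k), edgeDiff c f i ^ 2 / r i = ∑ i ∈ words n, t i ^ 2 * r i := by
  let u : List (Fin 3) → ℝ := fun k => t (k.take n) * slopeSign (k.drop n)
  have hu : ∀ k, n ≤ k.length → ∀ a, u (k ++ [a]) = u k * ![-1, 1, 0] a := by
    intro k hk a
    simp only [u, List.take_append_of_le_length hk, List.drop_append_of_le_length hk, slopeSign,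
      List.map_append, List.prod_append, mul_assoc]
    simp
  obtain ⟨f, hf⟩ := exists_edgeDiff_eq_of_split hT h0 h1 n (fun k => u k * r k) (by
    intro i hi
    rw [hu i hi, hu i hi, hr.split i]
    simp
    ring)
  have hS : ∀ j, |slopeSign j| ≤ 1 := by
    intro j
    induction j with
    | nil => simp [slopeSign]
    | cons a j ih =>
      have e : slopeSign (a :: j) = ![-1, 1, 0] a * slopeSign j := by simp [slopeSign]
      rw [e, abs_mul]
      have h3 : |(![-1, 1, 0] a : ℝ)| ≤ 1 := by fin_cases a <;> simp
      exact mul_le_one₀ h3 (abs_nonneg _) ih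
  have hui : ∀ i ∈ words n, ∀ j, u (i ++ j) = t i * slopeSign j := by
    intro i hi j
    have := mem_words.1 hi
    simp only [u]
    rw [List.take_left' this, List.drop_left' this]
  refine ⟨f, fun i hi => ?_, fun i hi j => ?_, fun k => ?_⟩
  · rw [hf i (mem_words.1 hi).ge]
    have := hui i hi []
    rw [List.append_nil] at this
    rw [this]
    simp [slopeSign]
  · rw [hf _ (by simp [mem_words.1 hi]), hui i hi, abs_mul, abs_mul, abs_of_pos (hr.pos _)]
    have := hS j
    have := (hr.pos (i ++ j)).le
    gcongr
    exact mul_le_of_le_one_right (abs_nonneg _) (hS j)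
  · have hsq : ∀ i, n ≤ i.length → edgeDiff c f i ^ 2 / r i = u i ^ 2 * r i := by
      intro i hi
      have := (hr.pos i).ne'
      rw [hf i hi]
      field_simp
    induction k with
    | zero =>
      refine Finset.sum_congr rfl fun i hi => ?_
      rw [hsq i (mem_words.1 hi).ge]
      have := hui i hi []
      rw [List.append_nil] at this
      rw [this]
      simp [slopeSign]
    | succ k ih =>
      rw [← ih, ← add_assoc, sum_words_succ']
      refine Finset.sum_congr rfl fun i hi => ?_
      have hi' : n ≤ i.length := by rw [mem_words.1 hi]; omega
      have hi2 : ∀ a : Fin 3, n ≤ (i ++ [a]).length := fun a => by simp; omega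
      rw [hsq i hi', Fin.sum_univ_three, hsq _ (hi2 _), hsq _ (hi2 _), hsq _ (hi2 _), hu i hi',
        hu i hi', hu i hi', hr.split i]
      simp
      ring

theorem exists_affine_isLip {c : ℝ} {T : Set (ℝ × ℝ)} (hT : IsSelfSimilarDendrite c T)
    (h0 : 0 < c) (h1 : c < 1 / 2) {r : List (Fin 3) → ℝ} (hr : IsResistanceWeight r) (n : ℕ)
    (t : List (Fin 3) → ℝ) (ht : ∀ i ∈ words n, |t i| ≤ 1) : ∃ f : ℝ × ℝ → ℝ,
      IsLip c r f ∧ (∀ i ∈ words n, edgeDiff c f i = t i * r i) ∧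
      (∀ i ∈ words n, t i = 0 → ∀ j, edgeDiff c f (i ++ j) = 0) ∧
      ∀ k, ∑ i ∈ words (n + k), edgeDiff c f i ^ 2 / r i = ∑ i ∈ words n, t i ^ 2 * r i := by
  obtain ⟨f, hf, hb, hE⟩ := exists_affine hT h0 h1 hr n t
  refine ⟨f, isLip_of_le_length hr n fun i hi => ?_, hf, fun i hi hti j => ?_, hE⟩
  · have hi' : i.take n ∈ words n := mem_words.2 (by rw [List.length_take]; omega)
    have := hb _ hi' (i.drop n)
    rw [List.take_append_drop] at this
    exact this.trans (mul_le_of_le_one_left (hr.pos i).le (ht _ hi'))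
  · have := hb i hi j
    rw [hti, abs_zero, zero_mul] at this
    exact abs_nonpos_iff.1 this

theorem eq_of_edgeDiff_append_eq_zero {c : ℝ} {f : ℝ × ℝ → ℝ} {i : List (Fin 3)}
    (h : ∀ j, edgeDiff c f (i ++ j) = 0) {x y : ℝ × ℝ} (hx : x ∈ vertexSetStar c)
    (hy : y ∈ vertexSetStar c) : f (psiWord c i x) = f (psiWord c i y) := by
  obtain ⟨n, hn⟩ := mem_vertexSetStar.1 hx
  obtain ⟨m, hm⟩ := mem_vertexSetStar.1 hy
  have := sub_eq_sub_of_edgeDiff_eq (c := c) (n := max n m) (f := f ∘ psiWord c i)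
    (g := fun _ => 0) (fun j _ => by rw [← edgeDiff_append, h]; simp [edgeDiff])
    (vertexSet_mono c (le_max_left _ _) hn) (vertexSet_mono c (le_max_right _ _) hm)
  simpa [sub_eq_zero] using this

/-! ### The resistance metric on the vertices -/

/-- The resistance `l(i) R_i` of the edge `i`. -/
noncomputable def edgeResistance (w : List (Fin 3) → ℝ) (i : List (Fin 3)) : ℝ :=
  cascadeLength w i * resistancePerturbation w i

theorem energy_eq_sum_words (c : ℝ) (w : List (Fin 3) → ℝ) (n : ℕ) (f : ℝ × ℝ → ℝ) :
    energy c w n f = ∑ i ∈ words n, edgeDiff c f i ^ 2 / edgeResistance w i := by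
  rw [← sum_ofFn_eq_sum_words, energy]
  refine Finset.sum_congr rfl fun i _ => ?_
  rw [edgeDiff, edgeResistance, one_div, inv_mul_eq_div]

/-- Subdividing the edges increases the energy. -/
theorem energy_mono {c : ℝ} {w : List (Fin 3) → ℝ} (hr : IsResistanceWeight (edgeResistance w))
    (f : ℝ × ℝ → ℝ) : Monotone fun n => energy c w n f := by
  refine monotone_nat_of_le_succ fun n => ?_
  rw [energy_eq_sum_words, energy_eq_sum_words, sum_words_succ']
  refine Finset.sum_le_sum fun i _ => ?_
  rw [Fin.sum_univ_three, hr.split i, edgeDiff_split]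
  generalize edgeDiff c f (i ++ [0]) = u
  generalize edgeDiff c f (i ++ [1]) = v
  have h0 := hr.pos (i ++ [0])
  have h1 := hr.pos (i ++ [1])
  have h2 : 0 ≤ edgeDiff c f (i ++ [2]) ^ 2 / edgeResistance w (i ++ [2]) :=
    div_nonneg (sq_nonneg _) (hr.pos _).le
  generalize edgeResistance w (i ++ [0]) = p at *
  generalize edgeResistance w (i ++ [1]) = q at *
  have h3 : (v - u) ^ 2 / (p + q) ≤ u ^ 2 / p + v ^ 2 / q := by
    rw [div_add_div _ _ h0.ne' h1.ne', div_le_div_iff₀ (by positivity) (by positivity)]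
    nlinarith [sq_nonneg (u * q + v * p), mul_pos h0 h1]
  linarith

/-- The effective resistance between two vertices is the largest difference of a function that
changes along each edge by at most its resistance. -/
theorem resistanceStar_spec {c : ℝ} {T : Set (ℝ × ℝ)} (hT : IsSelfSimilarDendrite c T)
    (h0 : 0 < c) (h1 : c < 1 / 2) {w : List (Fin 3) → ℝ}
    (hr : IsResistanceWeight (edgeResistance w)) {x y : ℝ × ℝ} (hx : x ∈ vertexSetStar c)
    (hy : y ∈ vertexSetStar c) :
    (∀ f, IsLip c (edgeResistance w) f → |f x - f y| ≤ resistanceStar c w x y) ∧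
      ∃ f, IsLip c (edgeResistance w) f ∧ f x - f y = resistanceStar c w x y := by
  by_cases hxy : x = y
  · subst hxy
    refine ⟨by simp [resistanceStar], fun _ => 0, fun i => ?_, by simp [resistanceStar]⟩
    simpa [edgeDiff] using (hr.pos i).le
  obtain ⟨n, hn⟩ := mem_vertexSetStar.1 hx
  obtain ⟨m, hm⟩ := mem_vertexSetStar.1 hy
  replace hn := vertexSet_mono c (le_max_left n m) hn
  replace hm := vertexSet_mono c (le_max_right n m) hm
  generalize max n m = N at hn hm
  obtain ⟨ε, hε, hsum⟩ := exists_path N hn hm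
  have hε1 : ∀ i, |ε i| ≤ 1 := by
    intro i
    rcases hε i with h | h | h <;> simp [h]
  set r := edgeResistance w with hrdef
  obtain ⟨f, hfL, hf, -, hE⟩ := exists_affine_isLip hT h0 h1 hr N ε fun i _ => hε1 i
  -- the length of the path
  set L := ∑ i ∈ words N, ε i ^ 2 * r i with hL
  have hfxy : f x - f y = L := by
    rw [hsum, hL]
    refine Finset.sum_congr rfl fun i hi => ?_
    rw [hf i hi]
    ring
  have hLpos : 0 < L := by
    have hnn : ∀ i ∈ words N, 0 ≤ ε i ^ 2 * r i := fun i _ =>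
      mul_nonneg (sq_nonneg _) (hr.pos i).le
    refine lt_of_le_of_ne (Finset.sum_nonneg hnn) fun h => hxy ?_
    have hz := (Finset.sum_eq_zero_iff_of_nonneg hnn).1 h.symm
    classical
    have := hsum fun z => if z = x then 1 else 0
    rw [Finset.sum_eq_zero] at this
    · by_contra hne
      simp [Ne.symm hne] at this
    · intro i hi
      have h3 := (mul_eq_zero.1 (hz i hi)).resolve_right (hr.pos i).ne'
      rw [pow_eq_zero_iff two_ne_zero] at h3
      rw [h3, zero_mul]
  have hmain : resistanceStar c w x y = L := by
    have hleast : IsLeast {e : ℝ | ∃ f : ℝ × ℝ → ℝ, f x = 0 ∧ f y = 1 ∧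
        Tendsto (fun n => energy c w n f) atTop (𝓝 e)} L⁻¹ := by
      constructor
      · refine ⟨fun z => (f x - f z) / L, by simp, by
          simp only [hfxy, div_self hLpos.ne'], ?_⟩
        refine tendsto_const_nhds.congr' ?_
        filter_upwards [eventually_ge_atTop N] with n hn
        obtain ⟨k, rfl⟩ := Nat.exists_eq_add_of_le hn
        have e : ∀ i, edgeDiff c (fun z => (f x - f z) / L) i ^ 2 / r i =
            edgeDiff c f i ^ 2 / r i * (L ^ 2)⁻¹ := by
          intro i
          simp only [edgeDiff]
          field_simp
          ring
        rw [energy_eq_sum_words, ← hrdef, Finset.sum_congr rfl fun i _ => e i, ← Finset.sum_mul,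
          hE k]
        field_simp
      · rintro e ⟨g, hgx, hgy, hlim⟩
        have h2 : energy c w N g ≤ e := (energy_mono hr g).ge_of_tendsto hlim N
        refine le_trans ?_ h2
        rw [energy_eq_sum_words, ← hrdef]
        have h3 : (∑ i ∈ words N, ε i * edgeDiff c g i) ^ 2 ≤
            L * ∑ i ∈ words N, edgeDiff c g i ^ 2 / r i := by
          refine Finset.sum_sq_le_sum_mul_sum_of_sq_le_mul _
            (fun i _ => mul_nonneg (sq_nonneg _) (hr.pos i).le)
            (fun i _ => div_nonneg (sq_nonneg _) (hr.pos i).le) fun i _ => ?_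
          have := (hr.pos i).ne'
          refine le_of_eq ?_
          field_simp
        rw [← hsum, hgx, hgy] at h3
        rw [inv_le_iff_one_le_mul₀' hLpos]
        simpa using h3
    rw [resistanceStar, if_neg hxy, hleast.csInf_eq, inv_inv]
  rw [hmain]
  refine ⟨fun g hg => ?_, f, hfL, hfxy⟩
  rw [hsum, hL]
  refine (Finset.abs_sum_le_sum_abs _ _).trans (Finset.sum_le_sum fun i _ => ?_)
  rw [abs_mul]
  have h2 : ε i ^ 2 = |ε i| := by
    rcases hε i with h | h | h <;> simp [h]
  rw [h2]
  exact mul_le_mul_of_nonneg_left (hg i) (abs_nonneg _)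

/-! ### Resistance diameters of the cells -/

/-- The sums of the `β`-th powers of the weights of level `n` decay geometrically in `n`. -/
def HasGeometricDecay (r : List (Fin 3) → ℝ) (β : ℝ) : Prop :=
  ∃ C ρ : ℝ, 0 < ρ ∧ ρ < 1 ∧ ∀ n, ∑ i ∈ words n, r i ^ β ≤ C * ρ ^ n

/-- If the weights below the edge `i` are at most `q` and decay at the rate `s` in the level, then
the vertices below `i` are reached from `ψ_i(0, 0)` by a chain of edges of total weight at most
`q / (1 - s)`, one edge for each level. -/
theorem IsLip.abs_sub_le_of_decay {c : ℝ} {r : List (Fin 3) → ℝ} {f : ℝ × ℝ → ℝ}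
    (hf : IsLip c r f) {s : ℝ} (hs0 : 0 < s) (hs1 : s < 1) {e : ℝ × ℝ}
    (he : e = (0, 0) ∨ e = (1, 0)) (j i : List (Fin 3)) {q : ℝ}
    (hq : ∀ k, r (i ++ k) ≤ s ^ k.length * q) :
    |f (psiWord c (i ++ j) e) - f (psiWord c i (0, 0))| ≤ q / (1 - s) := by
  have hs : 0 < 1 - s := by linarith
  induction j generalizing i q with
  | nil =>
    have h := hf i
    have hq0 := hq []
    simp only [List.append_nil, List.length_nil, pow_zero, one_mul] at hq0 ⊢
    have hq1 : 0 ≤ q := (abs_nonneg _).trans (h.trans hq0)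
    have hq2 : q ≤ q / (1 - s) := le_div_self hq1 hs (by linarith)
    rcases he with rfl | rfl
    · simp only [sub_self, abs_zero]
      positivity
    · rw [abs_sub_comm]
      exact h.trans (hq0.trans hq2)
  | cons a j ih =>
    have h3 := ih (i ++ [a]) (q := s * q) fun k => by
      have := hq ([a] ++ k)
      rw [← List.append_assoc] at this
      refine this.trans (le_of_eq ?_)
      simp [pow_succ]
      ring
    have h4 : |f (psiWord c (i ++ [a]) (0, 0)) - f (psiWord c i (0, 0))| ≤ q := by
      have h5 := hf (i ++ [0])
      have h6 : edgeDiff c f (i ++ [0]) =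
          f (psiWord c (i ++ [a]) (0, 0)) - f (psiWord c i (0, 0)) := by
        simp [edgeDiff, psiWord_append, psiWord_singleton, psi_origin, psi_zero_one]
      rw [h6] at h5
      have h7 := hq [0]
      simp only [List.length_singleton, pow_one] at h7
      have h8 : 0 ≤ s * q := (abs_nonneg _).trans (h5.trans h7)
      have h9 : 0 ≤ q := nonneg_of_mul_nonneg_right h8 hs0
      exact h5.trans (h7.trans (mul_le_of_le_one_left h9 hs1.le))
    have e1 : i ++ a :: j = i ++ [a] ++ j := by simp
    rw [e1]
    have h10 := abs_sub_le (f (psiWord c (i ++ [a] ++ j) e)) (f (psiWord c (i ++ [a]) (0, 0)))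
      (f (psiWord c i (0, 0)))
    have h11 : q / (1 - s) = s * q / (1 - s) + q := by
      field_simp
      ring
    rw [h11]
    linarith

/-- Bounds `D i` for the resistance diameters of the cells whose `β`-th powers have a sum over the
cells of level `n` that tends to `0` with `n`. -/
theorem exists_cell_bound {c : ℝ} {r : List (Fin 3) → ℝ} (hr : IsResistanceWeight r) {β : ℝ}
    (hβ : 0 < β) (hdec : HasGeometricDecay r β) : ∃ D : List (Fin 3) → ℝ, (∀ i, 0 ≤ D i) ∧
      (∀ f, IsLip c r f → ∀ i, ∀ x ∈ vertexSetStar c, ∀ y ∈ vertexSetStar c,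
        |f (psiWord c i x) - f (psiWord c i y)| ≤ D i) ∧
      Tendsto (fun n => ∑ i ∈ words n, D i ^ β) atTop (𝓝 0) := by
  obtain ⟨C, ρ, hρ0, hρ1, hC⟩ := hdec
  -- half of the decay pays for a geometric rate inside the cells
  set σ := √ρ with hσ
  have hσ0 : 0 < σ := Real.sqrt_pos.2 hρ0
  have hσ1 : σ < 1 := (Real.sqrt_lt' one_pos).2 (by simpa using hρ1)
  have hσρ : ρ = σ * σ := (Real.mul_self_sqrt hρ0.le).symm
  let a : List (Fin 3) → ℕ → ℝ := fun i k => (σ⁻¹) ^ k * ∑ j ∈ words k, r (i ++ j) ^ β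
  have hrβ : ∀ i, 0 ≤ r i ^ β := fun i => Real.rpow_nonneg (hr.pos i).le β
  have ha0 : ∀ i k, 0 ≤ a i k := fun i k =>
    mul_nonneg (by positivity) (Finset.sum_nonneg fun j _ => hrβ _)
  have hsum : ∀ n k, ∑ i ∈ words n, a i k ≤ C * ρ ^ n * σ ^ k := by
    intro n k
    simp only [a]
    rw [← Finset.mul_sum, ← sum_words_add n k fun i => r i ^ β]
    calc (σ⁻¹) ^ k * ∑ i ∈ words (n + k), r i ^ β ≤ (σ⁻¹) ^ k * (C * ρ ^ (n + k)) := by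
          gcongr
          exact hC _
      _ = C * ρ ^ n * σ ^ k := by
          rw [pow_add, inv_pow]
          nth_rewrite 2 [hσρ]
          rw [mul_pow]
          field_simp
  have ha : ∀ i k, a i k ≤ C * ρ ^ i.length * σ ^ k := fun i k =>
    (Finset.single_le_sum (f := fun i => a i k) (fun j _ => ha0 j k) (mem_words.2 rfl)).trans
      (hsum _ k)
  have hgeo := summable_geometric_of_lt_one hσ0.le hσ1
  have hsummable : ∀ i, Summable (a i) := fun i =>
    Summable.of_nonneg_of_le (ha0 i) (ha i) (hgeo.mul_left _)
  let Q : List (Fin 3) → ℝ := fun i => ∑' k, a i k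
  have hQ0 : ∀ i, 0 ≤ Q i := fun i => tsum_nonneg (ha0 i)
  have hQsum : ∀ n, ∑ i ∈ words n, Q i ≤ C / (1 - σ) * ρ ^ n := by
    intro n
    simp only [Q]
    rw [← Summable.tsum_finsetSum fun i _ => hsummable i]
    calc ∑' k, ∑ i ∈ words n, a i k ≤ ∑' k, C * ρ ^ n * σ ^ k :=
          Summable.tsum_le_tsum (hsum n) (summable_sum fun i _ => hsummable i) (hgeo.mul_left _)
      _ = C / (1 - σ) * ρ ^ n := by
          rw [tsum_mul_left, tsum_geometric_of_lt_one hσ0.le hσ1]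
          ring
  set s := σ ^ β⁻¹ with hs
  have hs0 : 0 < s := Real.rpow_pos_of_pos hσ0 _
  have hs1 : s < 1 := Real.rpow_lt_one hσ0.le hσ1 (inv_pos.2 hβ)
  have hsβ : s ^ β = σ := Real.rpow_inv_rpow hσ0.le hβ.ne'
  have h1s : 0 < 1 - s := by linarith
  have hq : ∀ i k, r (i ++ k) ≤ s ^ k.length * Q i ^ β⁻¹ := by
    intro i k
    have hQi := hQ0 i
    have hsk : (s ^ k.length) ^ β = σ ^ k.length := by
      rw [← Real.rpow_natCast, ← Real.rpow_mul hs0.le, mul_comm, Real.rpow_mul hs0.le, hsβ,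
        Real.rpow_natCast]
    rw [← Real.rpow_le_rpow_iff (hr.pos _).le (by positivity) hβ,
      Real.mul_rpow (by positivity) (by positivity), Real.rpow_inv_rpow (hQ0 i) hβ.ne', hsk]
    have h2 : a i k.length ≤ Q i := (hsummable i).le_tsum _ fun j _ => ha0 i j
    have h3 : r (i ++ k) ^ β ≤ ∑ j ∈ words k.length, r (i ++ j) ^ β :=
      Finset.single_le_sum (f := fun j => r (i ++ j) ^ β) (fun j _ => hrβ _) (mem_words.2 rfl)
    calc r (i ++ k) ^ β ≤ ∑ j ∈ words k.length, r (i ++ j) ^ β := h3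
      _ = σ ^ k.length * a i k.length := by
          simp only [a]
          rw [inv_pow]
          field_simp
      _ ≤ _ := by gcongr
  refine ⟨fun i => 2 / (1 - s) * Q i ^ β⁻¹, fun i => ?_, fun f hf i x hx y hy => ?_, ?_⟩
  · have := hQ0 i
    positivity
  · have key : ∀ z ∈ vertexSetStar c,
        |f (psiWord c i z) - f (psiWord c i (0, 0))| ≤ Q i ^ β⁻¹ / (1 - s) := by
      intro z hz
      obtain ⟨n, hn⟩ := mem_vertexSetStar.1 hz
      obtain ⟨j, -, rfl | rfl⟩ := mem_vertexSet.1 hn <;> rw [← psiWord_append]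
      · exact hf.abs_sub_le_of_decay hs0 hs1 (Or.inl rfl) j i (hq i)
      · exact hf.abs_sub_le_of_decay hs0 hs1 (Or.inr rfl) j i (hq i)
    have h2 := abs_sub_le (f (psiWord c i x)) (f (psiWord c i (0, 0))) (f (psiWord c i y))
    have h3 := key x hx
    have h4 := key y hy
    rw [abs_sub_comm] at h4
    calc _ ≤ _ := h2
      _ ≤ Q i ^ β⁻¹ / (1 - s) + Q i ^ β⁻¹ / (1 - s) := add_le_add h3 h4
      _ = _ := by ring
  · have e : ∀ n, ∑ i ∈ words n, (2 / (1 - s) * Q i ^ β⁻¹) ^ β =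
        (2 / (1 - s)) ^ β * ∑ i ∈ words n, Q i := by
      intro n
      rw [Finset.mul_sum]
      refine Finset.sum_congr rfl fun i _ => ?_
      have := hQ0 i
      rw [Real.mul_rpow (by positivity) (by positivity), Real.rpow_inv_rpow (hQ0 i) hβ.ne']
    simp_rw [e]
    have hlim : Tendsto (fun n => ∑ i ∈ words n, Q i) atTop (𝓝 0) := by
      refine squeeze_zero (fun n => Finset.sum_nonneg fun i _ => hQ0 i) hQsum ?_
      simpa using (tendsto_pow_atTop_nhds_zero_of_lt_one hρ0.le hρ1).const_mul (C / (1 - σ))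
    simpa using hlim.const_mul _

theorem tendsto_rpow_inv_of_tendsto_zero {β : ℝ} (hβ : 0 < β) {S : ℕ → ℝ}
    (h : Tendsto S atTop (𝓝 0)) : Tendsto (fun n => S n ^ β⁻¹) atTop (𝓝 0) := by
  have := h.rpow_const (p := β⁻¹) (Or.inr (inv_pos.2 hβ).le)
  rwa [Real.zero_rpow (inv_pos.2 hβ).ne'] at this

theorem le_rpow_inv_sum {ι : Type*} {s : Finset ι} {D : ι → ℝ} (hD : ∀ i, 0 ≤ D i) {β : ℝ}
    (hβ : 0 < β) {i : ι} (hi : i ∈ s) : D i ≤ (∑ j ∈ s, D j ^ β) ^ β⁻¹ := by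
  rw [Real.le_rpow_inv_iff_of_pos (hD i)
    (Finset.sum_nonneg fun j _ => Real.rpow_nonneg (hD j) β) hβ]
  exact Finset.single_le_sum (f := fun j => D j ^ β) (fun j _ => Real.rpow_nonneg (hD j) β) hi

/-- Coverings by cells whose diameters have small `β`-sums bound the Hausdorff dimension. -/
theorem dimH_univ_le_of_sum_rpow_tendsto_zero {X : Type*} [EMetricSpace X]
    (K : List (Fin 3) → Set X) (hK : ∀ n x, ∃ i ∈ words n, x ∈ K i) {D : List (Fin 3) → ℝ}
    (hD : ∀ i, 0 ≤ D i) (hKD : ∀ i, ∀ x ∈ K i, ∀ y ∈ K i, edist x y ≤ ENNReal.ofReal (D i))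
    {β : ℝ} (hβ : 0 < β) (hlim : Tendsto (fun n => ∑ i ∈ words n, D i ^ β) atTop (𝓝 0)) :
    dimH (Set.univ : Set X) ≤ ENNReal.ofReal β := by
  borelize X
  have hdiam : ∀ i, Metric.ediam (K i) ≤ ENNReal.ofReal (D i) := fun i =>
    Metric.ediam_le (hKD i)
  have hmeas : Measure.hausdorffMeasure β (Set.univ : Set X) ≤ 0 := by
    refine (Measure.hausdorffMeasure_le_liminf_sum (ι := fun n => words n) β Set.univ (l := atTop)
      (fun n => ENNReal.ofReal ((∑ i ∈ words n, D i ^ β) ^ β⁻¹)) ?_ (fun n i => K i)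
      (Eventually.of_forall fun n i => ?_) (Eventually.of_forall fun n x _ => ?_)).trans ?_
    · rw [← ENNReal.ofReal_zero]
      exact ENNReal.tendsto_ofReal (tendsto_rpow_inv_of_tendsto_zero hβ hlim)
    · exact (hdiam i).trans (ENNReal.ofReal_le_ofReal (le_rpow_inv_sum hD hβ i.2))
    · obtain ⟨i, hi, hx⟩ := hK n x
      exact Set.mem_iUnion_of_mem (⟨i, hi⟩ : words n) hx
    · have hle : ∀ n, ∑ i : words n, Metric.ediam (K i) ^ β ≤
          ENNReal.ofReal (∑ i ∈ words n, D i ^ β) := by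
        intro n
        rw [ENNReal.ofReal_sum_of_nonneg fun i _ => Real.rpow_nonneg (hD i) β,
          ← Finset.sum_coe_sort (words n)]
        refine Finset.sum_le_sum fun i _ => ?_
        rw [← ENNReal.ofReal_rpow_of_nonneg (hD i) hβ.le]
        exact ENNReal.rpow_le_rpow (hdiam i) hβ.le
      have h2 : Tendsto (fun n => ∑ i : words n, Metric.ediam (K i) ^ β) atTop (𝓝 0) := by
        refine tendsto_of_tendsto_of_tendsto_of_le_of_le tendsto_const_nhds ?_
          (fun n => zero_le) hle
        rw [← ENNReal.ofReal_zero]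
        exact ENNReal.tendsto_ofReal hlim
      exact h2.liminf_eq.le
  have := dimH_le_of_hausdorffMeasure_ne_top (d := β.toNNReal) (s := (Set.univ : Set X)) (by
    rw [Real.coe_toNNReal β hβ.le]
    exact (hmeas.trans_lt ENNReal.zero_lt_top).ne)
  exact this

/-! ### The extension of the resistance metric to the dendrite -/

section dendrite

variable {c : ℝ} {T : Set (ℝ × ℝ)} (hT : IsSelfSimilarDendrite c T) (h0 : 0 < c) (h1 : c < 1 / 2)
  {w : List (Fin 3) → ℝ} (hr : IsResistanceWeight (edgeResistance w))

include hT h0 h1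

/-- Vertices close to `x` lie in a common cell of level `n` with `x`. -/
theorem exists_nhds_cell (n : ℕ) (x : ℝ × ℝ) : ∃ U ∈ 𝓝 x, ∀ u ∈ U, u ∈ vertexSetStar c →
    ∃ i ∈ words n, ∃ p ∈ vertexSetStar c, ∃ q ∈ T, u = psiWord c i p ∧ x = psiWord c i q := by
  classical
  let K : Set (ℝ × ℝ) := ⋃ i ∈ (words n).filter fun i => x ∉ psiWord c i '' T, psiWord c i '' T
  have hK : IsClosed K := isClosed_biUnion_finset fun i _ => hT.isClosed_cell h0 h1 i
  refine ⟨Kᶜ, hK.isOpen_compl.mem_nhds ?_, fun u hu huV => ?_⟩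
  · intro hx
    obtain ⟨i, hi, hxi⟩ := Set.mem_iUnion₂.1 hx
    exact (Finset.mem_filter.1 hi).2 hxi
  · obtain ⟨i, hi, p, hp, rfl⟩ :=
      hT.exists_psiWord_eq n (hT.vertexSetStar_subset h0 h1 huV)
    by_cases hx : x ∈ psiWord c i '' T
    · obtain ⟨q, hq, rfl⟩ := hx
      exact ⟨i, hi, p, hT.mem_image_vertexSetStar h0 h1 hp huV, q, hq, rfl, rfl⟩
    · have hK : psiWord c i p ∈ K :=
        Set.mem_iUnion₂.2 ⟨i, Finset.mem_filter.2 ⟨hi, hx⟩, p, hp, rfl⟩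
      exact absurd hK hu

/-- A point that lies in two cells of level `n` is a vertex of both, unless the cells are equal. -/
theorem cell_eq_or_mem_vertexSetStar {n : ℕ} {i j : List (Fin 3)} (hi : i ∈ words n) (hj : j ∈ words n)
    {p q : ℝ × ℝ} (hp : p ∈ T) (hq : q ∈ T) (h : psiWord c i p = psiWord c j q) :
    i = j ∨ (p ∈ vertexSetStar c ∧ q ∈ vertexSetStar c) := by
  have hlen : i.length = j.length := (mem_words.1 hi).trans (mem_words.1 hj).symm
  by_cases hij : i = j
  · exact Or.inl hij
  · exact Or.inr ⟨end_mem_vertexSetStar c (hT.eq_end_of_psiWord_eq h0 h1 hlen hij hp hq h),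
      end_mem_vertexSetStar c (hT.eq_end_of_psiWord_eq h0 h1 hlen.symm (Ne.symm hij) hq hp h.symm)⟩

include hr

theorem resistanceStar_comm {x y : ℝ × ℝ} (hx : x ∈ vertexSetStar c)
    (hy : y ∈ vertexSetStar c) : resistanceStar c w x y = resistanceStar c w y x := by
  have key : ∀ x ∈ vertexSetStar c, ∀ y ∈ vertexSetStar c,
      resistanceStar c w x y ≤ resistanceStar c w y x := by
    intro x hx y hy
    obtain ⟨f, hf, h⟩ := (resistanceStar_spec hT h0 h1 hr hx hy).2
    have h2 := (resistanceStar_spec hT h0 h1 hr hy hx).1 f hf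
    rw [abs_sub_comm, h] at h2
    exact (le_abs_self _).trans h2
  exact le_antisymm (key x hx y hy) (key y hy x hx)

theorem resistanceStar_triangle {x y z : ℝ × ℝ} (hx : x ∈ vertexSetStar c)
    (hy : y ∈ vertexSetStar c) (hz : z ∈ vertexSetStar c) :
    resistanceStar c w x z ≤ resistanceStar c w x y + resistanceStar c w y z := by
  obtain ⟨f, hf, h⟩ := (resistanceStar_spec hT h0 h1 hr hx hz).2
  have h2 := (abs_le.1 ((resistanceStar_spec hT h0 h1 hr hx hy).1 f hf)).2
  have h3 := (abs_le.1 ((resistanceStar_spec hT h0 h1 hr hy hz).1 f hf)).2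
  linarith

theorem resistanceStar_psiWord_le {D : List (Fin 3) → ℝ}
    (hD : ∀ f, IsLip c (edgeResistance w) f → ∀ i, ∀ x ∈ vertexSetStar c,
      ∀ y ∈ vertexSetStar c, |f (psiWord c i x) - f (psiWord c i y)| ≤ D i)
    (i : List (Fin 3)) {x y : ℝ × ℝ} (hx : x ∈ vertexSetStar c) (hy : y ∈ vertexSetStar c) :
    resistanceStar c w (psiWord c i x) (psiWord c i y) ≤ D i := by
  obtain ⟨f, hf, h⟩ := (resistanceStar_spec hT h0 h1 hr (psiWord_mem_vertexSetStar i hx)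
    (psiWord_mem_vertexSetStar i hy)).2
  rw [← h]
  exact (le_abs_self _).trans (hD f hf i x hx y hy)

/-- Vertices that are close in the plane are close in the resistance metric. -/
theorem exists_nhds_resistanceStar_le {β : ℝ} (hβ : 0 < β)
    (hdec : HasGeometricDecay (edgeResistance w) β) (x : ℝ × ℝ) {η : ℝ} (hη : 0 < η) :
    ∃ U ∈ 𝓝 x, ∀ u ∈ U, ∀ v ∈ U, u ∈ vertexSetStar c → v ∈ vertexSetStar c →
      resistanceStar c w u v ≤ η := by
  obtain ⟨D, hD0, hD, hlim⟩ := exists_cell_bound (c := c) hr hβ hdec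
  obtain ⟨n, hn⟩ := ((tendsto_rpow_inv_of_tendsto_zero hβ hlim).eventually
    (gt_mem_nhds (half_pos hη))).exists
  have hDn : ∀ i ∈ words n, D i ≤ η / 2 := fun i hi =>
    (le_rpow_inv_sum hD0 hβ hi).trans hn.le
  obtain ⟨U, hU, h⟩ := exists_nhds_cell hT h0 h1 n x
  refine ⟨U, hU, fun u hu v hv huV hvV => ?_⟩
  obtain ⟨i, hi, p, hp, p', hp', rfl, hx⟩ := h u hu huV
  obtain ⟨j, hj, q, hq, q', hq', rfl, hx'⟩ := h v hv hvV
  rcases cell_eq_or_mem_vertexSetStar hT h0 h1 hi hj hp' hq' (hx.symm.trans hx') with rfl | ⟨hpe, hqe⟩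
  · have := resistanceStar_psiWord_le hT h0 h1 hr hD i hp hq
    linarith [hDn i hi]
  · have h2 := resistanceStar_psiWord_le hT h0 h1 hr hD i hp hpe
    have h3 := resistanceStar_psiWord_le hT h0 h1 hr hD j hqe hq
    rw [← hx] at h2
    rw [← hx'] at h3
    have h4 := resistanceStar_triangle hT h0 h1 hr huV
      (y := x) (hx ▸ psiWord_mem_vertexSetStar i hpe) hvV
    linarith [hDn i hi, hDn j hj]

/-- Distinct points have neighbourhoods whose vertices keep a positive resistance distance: once
the cells of level `n` around the points are disjoint, a path between them passes an edge of level
`n` that belongs to none of these cells. -/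
theorem exists_nhds_le_resistanceStar {x y : ℝ × ℝ} (hx : x ∈ T) (hy : y ∈ T) (hxy : x ≠ y) :
    ∃ η > 0, ∃ U ∈ 𝓝 x, ∃ V ∈ 𝓝 y, ∀ u ∈ U, ∀ v ∈ V, u ∈ vertexSetStar c →
      v ∈ vertexSetStar c → η ≤ resistanceStar c w u v := by
  classical
  obtain ⟨B, hB⟩ := Metric.isBounded_iff.1 hT.2.1.isBounded
  have hd : 0 < dist x y / 2 := half_pos (dist_pos.2 hxy)
  have hlim : Tendsto (fun n : ℕ => (1 / 2 : ℝ) ^ n * B) atTop (𝓝 0) := by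
    simpa using (tendsto_pow_atTop_nhds_zero_of_lt_one (r := (1 / 2 : ℝ)) (by norm_num)
      (by norm_num)).mul_const B
  obtain ⟨n, hn⟩ := (hlim.eventually (gt_mem_nhds hd)).exists
  have hsmall : ∀ i ∈ words n, ∀ p ∈ T, ∀ q ∈ T,
      dist (psiWord c i p) (psiWord c i q) < dist x y / 2 := by
    intro i hi p hp q hq
    refine (psiWord_dist_le h0 h1 i _ _).trans_lt (lt_of_le_of_lt ?_ hn)
    rw [mem_words.1 hi]
    gcongr
    exact hB hp hq
  obtain ⟨U, hU, hUc⟩ := exists_nhds_cell hT h0 h1 n x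
  obtain ⟨V, hV, hVc⟩ := exists_nhds_cell hT h0 h1 n y
  obtain ⟨i₀, hi₀, p₀, hp₀, rfl⟩ := hT.exists_psiWord_eq n hx
  obtain ⟨j₀, hj₀, q₀, hq₀, rfl⟩ := hT.exists_psiWord_eq n hy
  set x := psiWord c i₀ p₀ with hxdef
  set y := psiWord c j₀ q₀ with hydef
  have hz := hT.zero_mem h0 h1
  have ho := hT.one_mem h0 h1
  have hzV : ((0, 0) : ℝ × ℝ) ∈ vertexSetStar c := end_mem_vertexSetStar c (Or.inl rfl)
  obtain ⟨ε, hε, hsum⟩ := exists_path n (psiWord_mem_vertexSet (c := c) hi₀ (Or.inl rfl))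
    (psiWord_mem_vertexSet (c := c) hj₀ (Or.inl rfl))
  -- the edges of level `n` whose cells contain one of the two points
  let A : Set (List (Fin 3)) := {i | x ∈ psiWord c i '' T ∨ y ∈ psiWord c i '' T}
  let t : List (Fin 3) → ℝ := fun i => if i ∈ A then 0 else ε i
  have ht : ∀ i ∈ words n, |t i| ≤ 1 := by
    intro i _
    simp only [t]
    split_ifs
    · simp
    · rcases hε i with h | h | h <;> simp [h]
  obtain ⟨f, hfL, hf, hfc, -⟩ := exists_affine_isLip hT h0 h1 hr n t ht
  set r := edgeResistance w
  have hterm : ∀ i ∈ words n, 0 ≤ ε i * edgeDiff c f i := by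
    intro i hi
    rw [hf i hi]
    simp only [t]
    split_ifs
    · simp
    · have := (hr.pos i).le
      rw [← mul_assoc]
      exact mul_nonneg (mul_self_nonneg _) this
  have hpos : 0 < f (psiWord c i₀ (0, 0)) - f (psiWord c j₀ (0, 0)) := by
    rw [hsum]
    refine lt_of_le_of_ne (Finset.sum_nonneg hterm) fun h => ?_
    have hzero := (Finset.sum_eq_zero_iff_of_nonneg hterm).1 h.symm
    -- otherwise the path stays in the cells around the two points, which a function that is
    -- `1` on the cells around `x` and `0` on those around `y` excludes
    have h2 := hsum fun z => if dist z x < dist x y / 2 then 1 else 0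
    have hfar : ∀ z, dist z y < dist x y / 2 → ¬ dist z x < dist x y / 2 := by
      intro z h3 h4
      have := dist_triangle_left x y z
      linarith
    rw [Finset.sum_eq_zero, if_pos (hsmall i₀ hi₀ _ hz _ hp₀),
      if_neg (hfar _ (hsmall j₀ hj₀ _ hz _ hq₀))] at h2
    · norm_num at h2
    · intro i hi
      by_cases hA : i ∈ A
      · refine mul_eq_zero_of_right _ ?_
        rcases hA with ⟨p, hp, hpx⟩ | ⟨q, hq, hqy⟩
        · rw [edgeDiff, if_pos (hpx ▸ hsmall i hi _ hz _ hp), if_pos (hpx ▸ hsmall i hi _ ho _ hp),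
            sub_self]
        · rw [edgeDiff, if_neg (hfar _ (hqy ▸ hsmall i hi _ hz _ hq)),
            if_neg (hfar _ (hqy ▸ hsmall i hi _ ho _ hq)), sub_self]
      · have h3 := hzero i hi
        rw [hf i hi] at h3
        simp only [t, if_neg hA] at h3
        have h4 : ε i = 0 := by
          have := (hr.pos i).ne'
          simpa [this] using h3
        rw [h4, zero_mul]
  -- `f` is constant on the union of the cells around each of the two points
  have hconst : ∀ z ∈ ({x, y} : Set (ℝ × ℝ)), ∀ i ∈ words n, ∀ j ∈ words n, ∀ p ∈ vertexSetStar c,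
      ∀ p' ∈ T, ∀ q' ∈ T, z = psiWord c i p' → z = psiWord c j q' →
      f (psiWord c i p) = f (psiWord c j (0, 0)) := by
    intro z hz i hi j hj p hp p' hp' q' hq' hzi hzj
    have hAz : ∀ k ∈ words n, ∀ s ∈ T, z = psiWord c k s → ∀ l, edgeDiff c f (k ++ l) = 0 := by
      intro k hk s hs hzk
      refine hfc k hk (if_pos ?_)
      rcases hz with rfl | rfl
      exacts [Or.inl ⟨s, hs, hzk.symm⟩, Or.inr ⟨s, hs, hzk.symm⟩]
    have hi0 := hAz i hi p' hp' hzi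
    have hj0 := hAz j hj q' hq' hzj
    rcases cell_eq_or_mem_vertexSetStar hT h0 h1 hi hj hp' hq' (hzi.symm.trans hzj) with rfl | ⟨hpe, hqe⟩
    · exact eq_of_edgeDiff_append_eq_zero hi0 hp hzV
    · rw [eq_of_edgeDiff_append_eq_zero hi0 hp hpe, eq_of_edgeDiff_append_eq_zero hj0 hzV hqe,
        ← hzi, ← hzj]
  refine ⟨_, hpos, U, hU, V, hV, fun u hu v hv huV hvV => ?_⟩
  obtain ⟨i, hi, p, hp, p', hp', rfl, hxi⟩ := hUc u hu huV
  obtain ⟨j, hj, q, hq, q', hq', rfl, hyj⟩ := hVc v hv hvV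
  rw [← hconst x (Or.inl rfl) i hi i₀ hi₀ p hp p' hp' p₀ hp₀ hxi hxdef,
    ← hconst y (Or.inr rfl) j hj j₀ hj₀ q hq q' hq' q₀ hq₀ hyj hydef]
  exact (le_abs_self _).trans ((resistanceStar_spec hT h0 h1 hr huV hvV).1 f hfL)

/-- The resistance metric converges along the vertices that tend to two given points. -/
theorem exists_tendsto_resistanceStar {β : ℝ} (hβ : 0 < β)
    (hdec : HasGeometricDecay (edgeResistance w) β) {x y : ℝ × ℝ} (hx : x ∈ T) (hy : y ∈ T) :
    ∃ L, Tendsto (fun p : (ℝ × ℝ) × (ℝ × ℝ) => resistanceStar c w p.1 p.2)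
      (𝓝[vertexSetStar c] x ×ˢ 𝓝[vertexSetStar c] y) (𝓝 L) := by
  have : (𝓝[vertexSetStar c] x).NeBot :=
    mem_closure_iff_nhdsWithin_neBot.1 (hT.subset_closure_vertexSetStar h0 h1 hx)
  have : (𝓝[vertexSetStar c] y).NeBot :=
    mem_closure_iff_nhdsWithin_neBot.1 (hT.subset_closure_vertexSetStar h0 h1 hy)
  refine cauchy_map_iff_exists_tendsto.1 (Metric.cauchy_iff.2 ⟨inferInstance, fun η hη => ?_⟩)
  obtain ⟨U, hU, hUr⟩ := exists_nhds_resistanceStar_le hT h0 h1 hr hβ hdec x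
    (by positivity : 0 < η / 3)
  obtain ⟨V, hV, hVr⟩ := exists_nhds_resistanceStar_le hT h0 h1 hr hβ hdec y
    (by positivity : 0 < η / 3)
  refine ⟨_, image_mem_map (prod_mem_prod (inter_mem_nhdsWithin _ hU)
    (inter_mem_nhdsWithin _ hV)), ?_⟩
  rintro _ ⟨⟨u, v⟩, ⟨⟨hu, huU⟩, ⟨hv, hvV⟩⟩, rfl⟩ _ ⟨⟨u', v'⟩, ⟨⟨hu', huU'⟩, ⟨hv', hvV'⟩⟩, rfl⟩
  simp only at hu huU hv hvV hu' huU' hv' hvV'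
  have a1 := hUr u huU u' huU' hu hu'
  have a2 := hUr u' huU' u huU hu' hu
  have a3 := hVr v hvV v' hvV' hv hv'
  have a4 := hVr v' hvV' v hvV hv' hv
  have b1 := resistanceStar_triangle hT h0 h1 hr hu hu' hv
  have b2 := resistanceStar_triangle hT h0 h1 hr hu' hv' hv
  have b3 := resistanceStar_triangle hT h0 h1 hr hu' hu hv'
  have b4 := resistanceStar_triangle hT h0 h1 hr hu hv hv'
  rw [Real.dist_eq, abs_lt]
  constructor <;> simp only <;> linarith

/-- If the `β`-sums of the resistances of the edges decay geometrically for some `β > α`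
arbitrarily close to `α`, then the resistance metric extends to the dendrite, and makes it a metric
space of Hausdorff dimension at most `α`. -/
theorem exists_metricSpace_of_decay {α : ℝ} (hα : 0 < α)
    (hdec : ∀ γ, α < γ → ∃ β, α < β ∧ β ≤ γ ∧ HasGeometricDecay (edgeResistance w) β) : ∃ m : MetricSpace T,
      IsResistanceExtension c w (fun x y : T => m.dist x y) ∧
      @dimH T (@MetricSpace.toEMetricSpace T m) Set.univ ≤ ENNReal.ofReal α := by
  obtain ⟨β₁, hβ₁, -, hd1⟩ := hdec (α + 1) (by linarith)
  have hα1 : 0 < β₁ := hα.trans hβ₁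
  choose R hR using fun x y : T =>
    exists_tendsto_resistanceStar hT h0 h1 hr hα1 hd1 x.2 y.2
  have hext : ∀ (x y : T) (u v : ℕ → ℝ × ℝ), (∀ n, u n ∈ vertexSetStar c) →
      (∀ n, v n ∈ vertexSetStar c) → Tendsto u atTop (𝓝 (x : ℝ × ℝ)) →
      Tendsto v atTop (𝓝 (y : ℝ × ℝ)) →
      Tendsto (fun n => resistanceStar c w (u n) (v n)) atTop (𝓝 (R x y)) := by
    intro x y u v hu hv hux hvy
    exact (hR x y).comp ((tendsto_nhdsWithin_iff.2 ⟨hux, Eventually.of_forall hu⟩).prodMk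
      (tendsto_nhdsWithin_iff.2 ⟨hvy, Eventually.of_forall hv⟩))
  choose a ha hax using fun x : T =>
    mem_closure_iff_seq_limit.1 (hT.subset_closure_vertexSetStar h0 h1 x.2)
  have hlim : ∀ x y : T, Tendsto (fun n => resistanceStar c w (a x n) (a y n)) atTop
      (𝓝 (R x y)) := fun x y => hext x y _ _ (ha x) (ha y) (hax x) (hax y)
  have hself : ∀ x, R x x = 0 := fun x => by
    refine tendsto_nhds_unique (hlim x x) ?_
    simp [resistanceStar]
  have hcomm : ∀ x y, R x y = R y x := fun x y =>
    tendsto_nhds_unique (hlim x y) ((hlim y x).congr fun n =>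
      resistanceStar_comm hT h0 h1 hr (ha y n) (ha x n))
  have htri : ∀ x y z, R x z ≤ R x y + R y z := fun x y z =>
    le_of_tendsto_of_tendsto' (hlim x z) ((hlim x y).add (hlim y z)) fun n =>
      resistanceStar_triangle hT h0 h1 hr (ha x n) (ha y n) (ha z n)
  have heq : ∀ x y, R x y = 0 → x = y := by
    intro x y h
    by_contra hne
    obtain ⟨η, hη, U, hU, V, hV, hUV⟩ := exists_nhds_le_resistanceStar hT h0 h1 hr x.2 y.2
      fun e => hne (Subtype.ext e)
    have : η ≤ R x y := by
      refine ge_of_tendsto (hlim x y) ?_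
      filter_upwards [(hax x).eventually hU, (hax y).eventually hV] with n hu hv
      exact hUV _ hu _ hv (ha x n) (ha y n)
    linarith
  let m : MetricSpace T :=
    { dist := R
      dist_self := hself
      dist_comm := hcomm
      dist_triangle := htri
      eq_of_dist_eq_zero := fun {x y} h => heq x y h }
  refine ⟨m, hext, ?_⟩
  refine ENNReal.le_of_forall_pos_le_add fun δ hδ _ => ?_
  have hδ' : (0 : ℝ) < δ := hδ
  obtain ⟨β, hαβ, hβδ, hd⟩ := hdec (α + δ) (by linarith)
  have hβ : 0 < β := hα.trans hαβ
  obtain ⟨D, hD0, hD, hDlim⟩ := exists_cell_bound (c := c) hr hβ hd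
  have key := @dimH_univ_le_of_sum_rpow_tendsto_zero T (@MetricSpace.toEMetricSpace T m)
    (fun i => {x : T | (x : ℝ × ℝ) ∈ psiWord c i '' T}) (fun n x => ?_) D hD0
    (fun i x hx y hy => ?_) β hβ hDlim
  · refine key.trans ((ENNReal.ofReal_le_ofReal hβδ).trans ?_)
    rw [ENNReal.ofReal_add hα.le hδ'.le, ENNReal.ofReal_coe_nnreal]
  · obtain ⟨i, hi, q, hq, h⟩ := hT.exists_psiWord_eq n x.2
    exact ⟨i, hi, q, hq, h⟩
  · obtain ⟨p, hp, hpx⟩ := hx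
    obtain ⟨q, hq, hqy⟩ := hy
    have hcont := continuous_psiWord h0 h1 i
    have h3 := hext x y (fun n => psiWord c i (a ⟨p, hp⟩ n)) (fun n => psiWord c i (a ⟨q, hq⟩ n))
      (fun n => psiWord_mem_vertexSetStar i (ha _ n))
      (fun n => psiWord_mem_vertexSetStar i (ha _ n))
      (hpx ▸ (hcont.tendsto p).comp (hax ⟨p, hp⟩)) (hqy ▸ (hcont.tendsto q).comp (hax ⟨q, hq⟩))
    have h4 : R x y ≤ D i := le_of_tendsto' h3 fun n =>
      resistanceStar_psiWord_le hT h0 h1 hr hD i (ha _ n) (ha _ n)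
    exact (@edist_le_ofReal T m.toPseudoMetricSpace x y (D i) (hD0 i)).2 h4

end dendrite

/-! ### Product environments -/

/-- An environment: a triple of weights for each finite word. -/
abbrev Env : Type := List (Fin 3) → Fin 3 → ℝ

/-- The environment seen from the letter `a`. -/
def shift (a : Fin 3) (W : Env) : Env := fun i => W (a :: i)

/-- The environment with the triple `q.1` at the root and the three given subenvironments. -/
def glueEnv (q : (Fin 3 → ℝ) × Env × Env × Env) : Env
  | [] => q.1
  | 0 :: i => q.2.1 i
  | 1 :: i => q.2.2.1 i
  | 2 :: i => q.2.2.2 i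

theorem measurable_shift (a : Fin 3) : Measurable (shift a) :=
  measurable_pi_lambda _ fun i => measurable_pi_apply (a :: i)

theorem measurable_glueEnv : Measurable glueEnv := by
  refine measurable_pi_lambda _ fun i => ?_
  match i with
  | [] => exact measurable_fst
  | 0 :: i => exact (measurable_pi_apply i).comp (measurable_fst.comp measurable_snd)
  | 1 :: i =>
    exact (measurable_pi_apply i).comp (measurable_fst.comp (measurable_snd.comp measurable_snd))
  | 2 :: i =>
    exact (measurable_pi_apply i).comp (measurable_snd.comp (measurable_snd.comp measurable_snd))

theorem prod_finset_list {M : Type*} [CommMonoid M] (s : Finset (List (Fin 3)))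
    (g : List (Fin 3) → M) :
    ∏ i ∈ s, g i = (if [] ∈ s then g [] else 1) *
      ∏ a : Fin 3, ∏ i ∈ s.preimage (List.cons a) List.cons_injective.injOn,
        g (a :: i) := by
  classical
  rw [← Finset.prod_fiberwise s List.head?, Fintype.prod_option]
  congr 1
  · rw [Finset.prod_congr (s₂ := if [] ∈ s then {[]} else ∅) _ fun _ _ => rfl]
    · split_ifs <;> simp
    · ext i
      cases i <;> by_cases h : ([] : List (Fin 3)) ∈ s <;> simp [h]
  · refine Finset.prod_congr rfl fun a _ => ?_
    rw [Finset.prod_preimage']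
    refine Finset.prod_congr (Finset.filter_congr fun i _ => ?_) fun _ _ => rfl
    cases i with
    | nil => simp
    | cons b i => simp [eq_comm]

section product

variable (ν : Measure (Fin 3 → ℝ)) [IsProbabilityMeasure ν]

/-- The law of an environment with independent triples of law `ν`. -/
noncomputable def envLaw : Measure Env := Measure.infinitePi fun _ : List (Fin 3) => ν

instance : IsProbabilityMeasure (envLaw ν) :=
  inferInstanceAs (IsProbabilityMeasure (Measure.infinitePi fun _ : List (Fin 3) => ν))

/-- The triple at the root and the three subenvironments are independent, and the subenvironments
are copies of the whole environment. -/
theorem measurePreserving_glueEnv : MeasurePreserving glueEnv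
    (ν.prod ((envLaw ν).prod ((envLaw ν).prod (envLaw ν)))) (envLaw ν) := by
  classical
  refine ⟨measurable_glueEnv, Measure.eq_infinitePi _ fun s t ht => ?_⟩
  let S : Fin 3 → Finset (List (Fin 3)) := fun a =>
    s.preimage (List.cons a) List.cons_injective.injOn
  let B : Fin 3 → Set Env := fun a => Set.pi (S a) fun i => t (a :: i)
  have hB : ∀ a, envLaw ν (B a) = ∏ i ∈ S a, ν (t (a :: i)) := fun a =>
    Measure.infinitePi_pi _ fun i _ => ht _
  have hpre : glueEnv ⁻¹' Set.pi s t =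
      (if [] ∈ s then t [] else Set.univ) ×ˢ (B 0 ×ˢ (B 1 ×ˢ B 2)) := by
    ext q
    simp only [Set.mem_preimage, Set.mem_pi, Set.mem_prod, B, S, Finset.mem_coe,
      Finset.mem_preimage]
    constructor
    · intro h
      refine ⟨?_, fun i hi => h _ hi, fun i hi => h _ hi, fun i hi => h _ hi⟩
      split_ifs with h2
      exacts [h [] h2, Set.mem_univ _]
    · rintro ⟨h, hb0, hb1, hb2⟩ i hi
      match i with
      | [] =>
        rw [if_pos hi] at h
        exact h
      | 0 :: i => exact hb0 i hi
      | 1 :: i => exact hb1 i hi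
      | 2 :: i => exact hb2 i hi
  rw [Measure.map_apply measurable_glueEnv (MeasurableSet.pi (Finset.countable_toSet s)
    fun i _ => ht i), hpre, Measure.prod_prod, Measure.prod_prod, Measure.prod_prod, hB, hB, hB,
    prod_finset_list s, Fin.prod_univ_three, ← mul_assoc (∏ i ∈ S 0, _)]
  congr 1
  split_ifs <;> simp

theorem measurePreserving_shift (a : Fin 3) :
    MeasurePreserving (shift a) (envLaw ν) (envLaw ν) :=
  ⟨measurable_shift a, Measure.map_infinitePi_infinitePi_of_inj (P := fun _ : List (Fin 3) => ν)
    (List.cons_injective (a := a))⟩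

theorem lintegral_root_mul_shift (a : Fin 3) {f : (Fin 3 → ℝ) → ENNReal} {g : Env → ENNReal}
    (hf : Measurable f) (hg : Measurable g) :
    ∫⁻ W, f (W []) * g (shift a W) ∂envLaw ν = (∫⁻ x, f x ∂ν) * ∫⁻ W, g W ∂envLaw ν := by
  have hF : Measurable fun W : Env => f (W []) * g (shift a W) :=
    (hf.comp (measurable_pi_apply _)).mul (hg.comp (measurable_shift a))
  rw [← (measurePreserving_glueEnv ν).lintegral_comp hF]
  have e : ∀ (a : Fin 3), ∃ π : Env × Env × Env → Env,
      MeasurePreserving π ((envLaw ν).prod ((envLaw ν).prod (envLaw ν))) (envLaw ν) ∧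
      ∀ q, shift a (glueEnv q) = π q.2 := by
    intro a
    fin_cases a
    · exact ⟨Prod.fst, measurePreserving_fst, fun q => rfl⟩
    · exact ⟨_, measurePreserving_fst.comp measurePreserving_snd, fun q => rfl⟩
    · exact ⟨_, measurePreserving_snd.comp measurePreserving_snd, fun q => rfl⟩
  obtain ⟨π, hπ, he⟩ := e a
  simp_rw [he]
  rw [← hπ.lintegral_comp hg]
  exact lintegral_prod_mul hf.aemeasurable (hg.comp hπ.measurable).aemeasurable

theorem integral_root_mul_shift_mul_shift {f : (Fin 3 → ℝ) → ℝ} {g h : Env → ℝ}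
    (hf : Measurable f) (hg : Measurable g) (hh : Measurable h) :
    ∫ W, f (W []) * (g (shift 0 W) * h (shift 1 W)) ∂envLaw ν =
      (∫ x, f x ∂ν) * ((∫ W, g W ∂envLaw ν) * ∫ W, h W ∂envLaw ν) := by
  have hF : Measurable fun W : Env => f (W []) * (g (shift 0 W) * h (shift 1 W)) :=
    (hf.comp (measurable_pi_apply _)).mul
      ((hg.comp (measurable_shift 0)).mul (hh.comp (measurable_shift 1)))
  have h1 := integral_prod_mul (μ := envLaw ν) (ν := envLaw ν) h fun _ => (1 : ℝ)
  have h2 := integral_prod_mul (μ := envLaw ν) (ν := (envLaw ν).prod (envLaw ν)) g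
    fun p => h p.1 * 1
  have h3 := integral_prod_mul (μ := ν) (ν := (envLaw ν).prod ((envLaw ν).prod (envLaw ν))) f
    fun p => g p.1 * (h p.2.1 * 1)
  rw [h2, h1] at h3
  simp only [mul_one, integral_const, probReal_univ, smul_eq_mul] at h3
  rw [← h3]
  conv_lhs => rw [← (measurePreserving_glueEnv ν).map_eq]
  rw [integral_map measurable_glueEnv.aemeasurable hF.aestronglyMeasurable]
  rfl

theorem ae_envLaw_of_ae {p : (Fin 3 → ℝ) → Prop} (hp : ∀ᵐ x ∂ν, p x) :
    ∀ᵐ W ∂envLaw ν, ∀ i, p (W i) :=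
  ae_all_iff.2 fun i =>
    (measurePreserving_eval_infinitePi (fun _ : List (Fin 3) => ν) i).quasiMeasurePreserving.ae hp

end product

/-! ### The mass of the cascade over the first two letters -/

/-- The total length `∑ l(j)` over the words `j` of length `n` in the first two letters. -/
def cascadeMass : ℕ → Env → ℝ
  | 0, _ => 1
  | n + 1, W => W [] 0 * cascadeMass n (shift 0 W) + W [] 1 * cascadeMass n (shift 1 W)

theorem measurable_root (a : Fin 3) : Measurable fun W : Env => W [] a :=
  (measurable_pi_apply a).comp (measurable_pi_apply ([] : List (Fin 3)))

theorem measurable_cascadeMass (n : ℕ) : Measurable (cascadeMass n) := by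
  induction n with
  | zero => exact measurable_const
  | succ n ih =>
    exact ((measurable_root 0).mul (ih.comp (measurable_shift 0))).add
      ((measurable_root 1).mul (ih.comp (measurable_shift 1)))

theorem cascadeMass_mem_Icc {W : Env} (hW : ∀ i j, 0 < W i j ∧ W i j ≤ 1) (n : ℕ) :
    cascadeMass n W ∈ Set.Icc (0 : ℝ) (2 ^ n) := by
  induction n generalizing W with
  | zero => simp [cascadeMass]
  | succ n ih =>
    have a0 := ih (W := shift 0 W) fun i j => hW _ j
    have a1 := ih (W := shift 1 W) fun i j => hW _ j
    have b0 := hW [] 0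
    have b1 := hW [] 1
    constructor
    · exact add_nonneg (mul_nonneg b0.1.le a0.1) (mul_nonneg b1.1.le a1.1)
    · have c0 := mul_le_of_le_one_left a0.1 b0.2
      have c1 := mul_le_of_le_one_left a1.1 b1.2
      have := a0.2
      have := a1.2
      rw [cascadeMass, pow_succ]
      linarith

section moments

variable {ν : Measure (Fin 3 → ℝ)} [IsProbabilityMeasure ν]
  (hν : ∀ᵐ x ∂ν, ∀ j, 0 < x j ∧ x j ≤ 1) (hA : ∫ x, (x 0 + x 1) ∂ν = 1)

include hν

theorem integrable_root_pow (p q : ℕ) : Integrable (fun x : Fin 3 → ℝ => x 0 ^ p * x 1 ^ q) ν := by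
  refine Integrable.of_bound (by fun_prop) 1 ?_
  filter_upwards [hν] with x hx
  rw [Real.norm_eq_abs, abs_mul, abs_pow, abs_pow, abs_of_pos (hx 0).1, abs_of_pos (hx 1).1]
  exact mul_le_one₀ (pow_le_one₀ (hx 0).1.le (hx 0).2) (pow_nonneg (hx 1).1.le _)
    (pow_le_one₀ (hx 1).1.le (hx 1).2)

theorem integral_root_pow_mem_Icc (p q : ℕ) :
    ∫ x : Fin 3 → ℝ, x 0 ^ p * x 1 ^ q ∂ν ∈ Set.Icc (0 : ℝ) 1 := by
  constructor
  · refine integral_nonneg_of_ae ?_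
    filter_upwards [hν] with x hx
    exact mul_nonneg (pow_nonneg (hx 0).1.le _) (pow_nonneg (hx 1).1.le _)
  · have : ∫ x : Fin 3 → ℝ, x 0 ^ p * x 1 ^ q ∂ν ≤ ∫ _, (1 : ℝ) ∂ν := by
      refine integral_mono_ae (integrable_root_pow hν p q) (integrable_const _) ?_
      filter_upwards [hν] with x hx
      exact mul_le_one₀ (pow_le_one₀ (hx 0).1.le (hx 0).2) (pow_nonneg (hx 1).1.le _)
        (pow_le_one₀ (hx 1).1.le (hx 1).2)
    simpa using this

theorem integrable_cascadeMass_comp (n : ℕ) {g : ℝ → ℝ} (hg : Continuous g) :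
    Integrable (fun W => g (cascadeMass n W)) (envLaw ν) := by
  obtain ⟨C, hC⟩ := (isCompact_Icc (a := (0 : ℝ)) (b := 2 ^ n)).exists_bound_of_continuousOn
    hg.continuousOn
  refine Integrable.of_bound (hg.measurable.comp (measurable_cascadeMass n)).aestronglyMeasurable
    C ?_
  filter_upwards [ae_envLaw_of_ae ν hν] with W hW
  exact hC _ (cascadeMass_mem_Icc hW n)

/-- Products of powers of the root weights and of bounded functions of the subenvironments are
integrable. -/
theorem integrable_root_mul_shift {g h : Env → ℝ} (hg : Measurable g) (hh : Measurable h) {B : ℝ}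
    (hgB : ∀ᵐ W ∂envLaw ν, |g W| ≤ B) (hhB : ∀ᵐ W ∂envLaw ν, |h W| ≤ B) (p q : ℕ) :
    Integrable (fun W : Env => W [] 0 ^ p * W [] 1 ^ q * (g (shift 0 W) * h (shift 1 W)))
      (envLaw ν) := by
  refine Integrable.of_bound (Measurable.aestronglyMeasurable ?_) (B * B) ?_
  · exact (((measurable_root 0).pow_const p).mul ((measurable_root 1).pow_const q)).mul
      ((hg.comp (measurable_shift 0)).mul (hh.comp (measurable_shift 1)))
  · filter_upwards [ae_envLaw_of_ae ν hν,
      (measurePreserving_shift ν 0).quasiMeasurePreserving.ae hgB,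
      (measurePreserving_shift ν 1).quasiMeasurePreserving.ae hhB] with W hW h1 h2
    rw [Real.norm_eq_abs, abs_mul, abs_mul, abs_mul, abs_pow, abs_pow, abs_of_pos (hW [] 0).1,
      abs_of_pos (hW [] 1).1]
    have hB : 0 ≤ B := (abs_nonneg _).trans h1
    have h3 : W [] 0 ^ p * W [] 1 ^ q ≤ 1 :=
      mul_le_one₀ (pow_le_one₀ (hW [] 0).1.le (hW [] 0).2) (pow_nonneg (hW [] 1).1.le _)
        (pow_le_one₀ (hW [] 1).1.le (hW [] 1).2)
    refine (mul_le_of_le_one_left (by positivity) h3).trans ?_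
    gcongr

include hA

/-- The second and higher moments of the root weights have a sum less than `1`, as the weights do
not take the value `1` only. -/
theorem integral_root_pow_lt_one {p : ℕ} (hp : 2 ≤ p) :
    ∫ x : Fin 3 → ℝ, x 0 ^ p ∂ν + ∫ x : Fin 3 → ℝ, x 1 ^ p ∂ν < 1 := by
  have i0 : ∀ p, Integrable (fun x : Fin 3 → ℝ => x 0 ^ p) ν := fun p => by
    simpa using integrable_root_pow hν p 0
  have i1 : ∀ p, Integrable (fun x : Fin 3 → ℝ => x 1 ^ p) ν := fun p => by
    simpa using integrable_root_pow hν 0 p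
  rw [← integral_add (i0 p) (i1 p)]
  have hint : Integrable (fun x : Fin 3 → ℝ => x 0 + x 1) ν := by
    have := (i0 1).add (i1 1)
    simp only [pow_one] at this
    exact this
  have hle : (fun x : Fin 3 → ℝ => x 0 ^ p + x 1 ^ p) ≤ᵐ[ν] fun x => x 0 + x 1 := by
    filter_upwards [hν] with x hx
    exact add_le_add (pow_le_of_le_one (hx 0).1.le (hx 0).2 (by omega))
      (pow_le_of_le_one (hx 1).1.le (hx 1).2 (by omega))
  have h1 := integral_mono_ae ((i0 p).add (i1 p)) hint hle
  rw [hA] at h1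
  refine lt_of_le_of_ne h1 fun h2 => ?_
  have h3 := (integral_eq_iff_of_ae_le ((i0 p).add (i1 p)) hint hle).1 (h2.trans hA.symm)
  have h4 : ∀ᵐ x ∂ν, x 0 + x 1 = 2 := by
    filter_upwards [hν, h3] with x hx hx3
    have key : ∀ y : ℝ, 0 < y → y ≤ 1 → y ^ p = y → y = 1 := by
      intro y hy0 hy1 hy
      by_contra hne
      exact (pow_lt_self_of_lt_one₀ hy0 (lt_of_le_of_ne hy1 hne) (by omega)).ne hy
    have a0 := pow_le_of_le_one (hx 0).1.le (hx 0).2 (n := p) (by omega)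
    have a1 := pow_le_of_le_one (hx 1).1.le (hx 1).2 (n := p) (by omega)
    have hx3 : x 0 ^ p + x 1 ^ p = x 0 + x 1 := hx3
    rw [key _ (hx 0).1 (hx 0).2 (by linarith), key _ (hx 1).1 (hx 1).2 (by linarith)]
    norm_num
  rw [integral_congr_ae h4] at hA
  norm_num at hA

theorem integral_cascadeMass (n : ℕ) : ∫ W, cascadeMass n W ∂envLaw ν = 1 := by
  induction n with
  | zero => simp [cascadeMass]
  | succ n ih =>
    have hm := measurable_cascadeMass n
    have hB : ∀ᵐ W ∂envLaw ν, |cascadeMass n W| ≤ 2 ^ n := by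
      filter_upwards [ae_envLaw_of_ae ν hν] with W hW
      have := cascadeMass_mem_Icc hW n
      rw [abs_of_nonneg this.1]
      exact this.2
    have h1B : ∀ᵐ _ : Env ∂envLaw ν, |(1 : ℝ)| ≤ 2 ^ n :=
      Eventually.of_forall fun _ => by simpa using one_le_pow₀ (by norm_num : (1 : ℝ) ≤ 2)
    have j0 := integrable_root_mul_shift hν hm measurable_const hB h1B 1 0
    have j1 := integrable_root_mul_shift hν measurable_const hm h1B hB 0 1
    have e0 := integral_root_mul_shift_mul_shift ν (f := fun x => x 0) (measurable_pi_apply 0) hm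
      (measurable_const (a := (1 : ℝ)))
    have e1 := integral_root_mul_shift_mul_shift ν (f := fun x => x 1) (measurable_pi_apply 1)
      (measurable_const (a := (1 : ℝ))) hm
    simp only [pow_one, pow_zero, mul_one, one_mul] at j0 j1 e0 e1
    have h0 : Integrable (fun x : Fin 3 → ℝ => x 0) ν := by
      simpa using integrable_root_pow hν 1 0
    have h1 : Integrable (fun x : Fin 3 → ℝ => x 1) ν := by
      simpa using integrable_root_pow hν 0 1
    simp only [cascadeMass]
    rw [integral_add j0 j1, e0, e1, ih]
    simp only [integral_const, probReal_univ, smul_eq_mul, mul_one]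
    rw [← integral_add h0 h1, hA]

/-- All moments of the masses are bounded: the binomial expansion of the recursion bounds the
moment of order `p` of the next mass by a contraction of that moment and products of moments of
lower order. -/
theorem exists_integral_cascadeMass_pow_le (p : ℕ) :
    ∃ K, ∀ n, ∫ W, cascadeMass n W ^ p ∂envLaw ν ≤ K := by
  induction p using Nat.strong_induction_on with
  | _ p ih =>
  match p with
  | 0 => exact ⟨1, by simp⟩
  | 1 => exact ⟨1, fun n => by simp [integral_cascadeMass hν hA n]⟩
  | p + 2 =>
    have hlt := integral_root_pow_lt_one hν hA (p := p + 2) (by omega)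
    set lam := ∫ x : Fin 3 → ℝ, x 0 ^ (p + 2) ∂ν + ∫ x : Fin 3 → ℝ, x 1 ^ (p + 2) ∂ν with hlam
    have hlam0 : 0 ≤ lam := by
      have a0 := (integral_root_pow_mem_Icc hν (p + 2) 0).1
      have a1 := (integral_root_pow_mem_Icc hν 0 (p + 2)).1
      simp only [pow_zero, mul_one, one_mul] at a0 a1
      exact add_nonneg a0 a1
    let M : ℕ → ℕ → ℝ := fun m n => ∫ W, cascadeMass n W ^ m ∂envLaw ν
    have hM0 : ∀ m n, 0 ≤ M m n := fun m n => by
      refine integral_nonneg_of_ae ?_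
      filter_upwards [ae_envLaw_of_ae ν hν] with W hW
      exact pow_nonneg (cascadeMass_mem_Icc hW n).1 m
    choose! K hK using ih
    have hrec : ∀ n, M (p + 2) (n + 1) = ∑ m ∈ Finset.range (p + 2 + 1),
        (∫ x : Fin 3 → ℝ, x 0 ^ m * x 1 ^ (p + 2 - m) ∂ν) * (M m n * M (p + 2 - m) n) *
          ((p + 2).choose m) := by
      intro n
      have hint : ∀ m ∈ Finset.range (p + 2 + 1), Integrable (fun W : Env =>
          W [] 0 ^ m * W [] 1 ^ (p + 2 - m) * (cascadeMass n (shift 0 W) ^ m *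
            cascadeMass n (shift 1 W) ^ (p + 2 - m)) * ((p + 2).choose m : ℝ)) (envLaw ν) := by
        intro m hm
        have hb : ∀ k ≤ p + 2, ∀ᵐ W ∂envLaw ν,
            |cascadeMass n W ^ k| ≤ ((2 : ℝ) ^ n) ^ (p + 2) := by
          intro k hk
          filter_upwards [ae_envLaw_of_ae ν hν] with W hW
          have := cascadeMass_mem_Icc hW n
          rw [abs_of_nonneg (pow_nonneg this.1 _)]
          have h1 : (1 : ℝ) ≤ 2 ^ n := one_le_pow₀ (by norm_num)
          exact (pow_le_pow_left₀ this.1 this.2 k).trans (pow_le_pow_right₀ h1 hk)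
        exact (integrable_root_mul_shift hν ((measurable_cascadeMass n).pow_const m)
          ((measurable_cascadeMass n).pow_const (p + 2 - m))
          (hb m (by simpa [Nat.lt_succ_iff] using hm)) (hb _ (Nat.sub_le _ _)) m
          (p + 2 - m)).mul_const _
      have e : ∀ W : Env, cascadeMass (n + 1) W ^ (p + 2) = ∑ m ∈ Finset.range (p + 2 + 1),
          W [] 0 ^ m * W [] 1 ^ (p + 2 - m) * (cascadeMass n (shift 0 W) ^ m *
            cascadeMass n (shift 1 W) ^ (p + 2 - m)) * ((p + 2).choose m : ℝ) := by
        intro W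
        rw [cascadeMass, add_pow]
        refine Finset.sum_congr rfl fun m _ => ?_
        rw [mul_pow, mul_pow]
        ring
      simp only [M]
      simp_rw [e]
      rw [integral_finsetSum _ hint]
      refine Finset.sum_congr rfl fun m _ => ?_
      rw [integral_mul_const]
      congr 1
      exact integral_root_mul_shift_mul_shift ν (f := fun x => x 0 ^ m * x 1 ^ (p + 2 - m))
        (by fun_prop) ((measurable_cascadeMass n).pow_const _)
        ((measurable_cascadeMass n).pow_const _)
    let B : ℝ := ∑ m ∈ Finset.range (p + 1),
      |K (m + 1)| * |K (p + 2 - (m + 1))| * ((p + 2).choose (m + 1))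
    have hstep : ∀ n, M (p + 2) (n + 1) ≤ lam * M (p + 2) n + B := by
      intro n
      have hM00 : M 0 n = 1 := by simp [M]
      rw [hrec n, Finset.sum_range_succ, Finset.sum_range_succ']
      have hmid : ∑ m ∈ Finset.range (p + 1),
          (∫ x : Fin 3 → ℝ, x 0 ^ (m + 1) * x 1 ^ (p + 2 - (m + 1)) ∂ν) *
            (M (m + 1) n * M (p + 2 - (m + 1)) n) * ((p + 2).choose (m + 1)) ≤ B := by
        refine Finset.sum_le_sum fun m hm => ?_
        rw [Finset.mem_range] at hm
        have b := integral_root_pow_mem_Icc hν (m + 1) (p + 2 - (m + 1))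
        have c1 := hM0 (m + 1) n
        have c2 := hM0 (p + 2 - (m + 1)) n
        have d1 : M (m + 1) n ≤ |K (m + 1)| := (hK _ (by omega) n).trans (le_abs_self _)
        have d2 : M (p + 2 - (m + 1)) n ≤ |K (p + 2 - (m + 1))| :=
          (hK _ (by omega) n).trans (le_abs_self _)
        refine mul_le_mul_of_nonneg_right ?_ (Nat.cast_nonneg _)
        refine (mul_le_of_le_one_left (mul_nonneg c1 c2) b.2).trans ?_
        gcongr
      simp only [Nat.sub_self, Nat.sub_zero, pow_zero, mul_one, one_mul, Nat.choose_self,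
        Nat.choose_zero_right, Nat.cast_one, hM00]
      have : lam * M (p + 2) n = (∫ x : Fin 3 → ℝ, x 1 ^ (p + 2) ∂ν) * M (p + 2) n +
          (∫ x : Fin 3 → ℝ, x 0 ^ (p + 2) ∂ν) * M (p + 2) n := by
        rw [hlam]
        ring
      linarith
    have hB0 : 0 ≤ B := Finset.sum_nonneg fun m _ => by positivity
    -- the fixed point of the recursion, enlarged by the initial value `1`
    refine ⟨1 + B / (1 - lam), fun n => ?_⟩
    have h1 : 0 < 1 - lam := by linarith
    have hfix : lam * (B / (1 - lam)) + B = B / (1 - lam) := by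
      field_simp
      ring
    induction n with
    | zero =>
      have : 0 ≤ B / (1 - lam) := by positivity
      simp only [cascadeMass, one_pow, integral_const, probReal_univ, smul_eq_mul, mul_one]
      linarith
    | succ n ihn =>
      have h2 := mul_le_mul_of_nonneg_left ihn hlam0
      have h3 := hstep n
      change M (p + 2) (n + 1) ≤ _
      have h4 : lam * M (p + 2) n ≤ lam * (1 + B / (1 - lam)) := h2
      have h5 : lam * (1 + B / (1 - lam)) = lam + lam * (B / (1 - lam)) := by ring
      linarith

/-- The increments of the masses decay geometrically in `L²`: the increments over the two
subenvironments are independent and centred. -/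
theorem exists_integral_sub_sq_le : ∃ C lam : ℝ, 0 ≤ lam ∧ lam < 1 ∧
    ∀ n, ∫ W, (cascadeMass (n + 1) W - cascadeMass n W) ^ 2 ∂envLaw ν ≤ C * lam ^ n := by
  have hlt := integral_root_pow_lt_one hν hA le_rfl
  have a0 := (integral_root_pow_mem_Icc hν 2 0).1
  have a1 := (integral_root_pow_mem_Icc hν 0 2).1
  simp only [pow_zero, mul_one, one_mul] at a0 a1
  refine ⟨∫ W, (cascadeMass 1 W - cascadeMass 0 W) ^ 2 ∂envLaw ν, _, add_nonneg a0 a1, hlt,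
    fun n => le_of_eq ?_⟩
  induction n with
  | zero => simp
  | succ n ih =>
    rw [pow_succ, ← mul_assoc, ← ih]
    set d : Env → ℝ := fun W => cascadeMass (n + 1) W - cascadeMass n W with hd
    have hdm : Measurable d := (measurable_cascadeMass (n + 1)).sub (measurable_cascadeMass n)
    have hdmean : ∫ W, d W ∂envLaw ν = 0 := by
      refine (integral_sub (integrable_cascadeMass_comp hν (n + 1) continuous_id)
        (integrable_cascadeMass_comp hν n continuous_id)).trans ?_
      simp [integral_cascadeMass hν hA]
    have hdB : ∀ᵐ W ∂envLaw ν, |d W| ≤ 2 ^ (n + 1) := by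
      filter_upwards [ae_envLaw_of_ae ν hν] with W hW
      have h1 := cascadeMass_mem_Icc hW (n + 1)
      have h2 := cascadeMass_mem_Icc hW n
      have h3 : (2 : ℝ) ^ n ≤ 2 ^ (n + 1) := pow_le_pow_right₀ (by norm_num) (by omega)
      rw [abs_le]
      constructor <;> simp only [hd] <;> linarith [h1.1, h1.2, h2.1, h2.2]
    have hone : (1 : ℝ) ≤ (2 ^ (n + 1)) ^ 2 := one_le_pow₀ (one_le_pow₀ (by norm_num))
    have hdB1 : ∀ᵐ W ∂envLaw ν, |d W| ≤ (2 ^ (n + 1)) ^ 2 := by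
      filter_upwards [hdB] with W hW
      have : (1 : ℝ) ≤ 2 ^ (n + 1) := one_le_pow₀ (by norm_num)
      exact hW.trans (le_self_pow₀ this (by norm_num))
    have hdB2 : ∀ᵐ W ∂envLaw ν, |d W ^ 2| ≤ (2 ^ (n + 1)) ^ 2 := by
      filter_upwards [hdB] with W hW
      rw [abs_pow]
      gcongr
    have h1B : ∀ᵐ _ : Env ∂envLaw ν, |(1 : ℝ)| ≤ (2 ^ (n + 1)) ^ 2 :=
      Eventually.of_forall fun _ => by simpa using hone
    have j0 := integrable_root_mul_shift hν (hdm.pow_const 2) measurable_const hdB2 h1B 2 0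
    have j1 := integrable_root_mul_shift hν measurable_const (hdm.pow_const 2) h1B hdB2 0 2
    have j2 := (integrable_root_mul_shift hν hdm hdm hdB1 hdB1 1 1).const_mul 2
    have e0 := integral_root_mul_shift_mul_shift ν (f := fun x => x 0 ^ 2) (by fun_prop)
      (hdm.pow_const 2) (measurable_const (a := (1 : ℝ)))
    have e1 := integral_root_mul_shift_mul_shift ν (f := fun x => x 1 ^ 2) (by fun_prop)
      (measurable_const (a := (1 : ℝ))) (hdm.pow_const 2)
    have e2 := integral_root_mul_shift_mul_shift ν (f := fun x => x 0 * x 1) (by fun_prop) hdm hdm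
    simp only [pow_one, pow_zero, mul_one, one_mul] at j0 j1 j2 e0 e1 e2
    have e : ∀ W : Env, (cascadeMass (n + 1 + 1) W - cascadeMass (n + 1) W) ^ 2 =
        W [] 0 ^ 2 * d (shift 0 W) ^ 2 + W [] 1 ^ 2 * d (shift 1 W) ^ 2 +
          2 * (W [] 0 * W [] 1 * (d (shift 0 W) * d (shift 1 W))) := by
      intro W
      have r1 : cascadeMass (n + 1 + 1) W = W [] 0 * cascadeMass (n + 1) (shift 0 W) +
        W [] 1 * cascadeMass (n + 1) (shift 1 W) := rfl
      have r2 : cascadeMass (n + 1) W = W [] 0 * cascadeMass n (shift 0 W) +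
        W [] 1 * cascadeMass n (shift 1 W) := rfl
      rw [r1, r2]
      simp only [hd]
      ring
    simp_rw [e]
    refine (integral_add (j0.add j1) j2).trans ?_
    refine (congrArg (· + _) (integral_add j0 j1)).trans ?_
    rw [integral_const_mul, e0, e1, e2, hdmean]
    simp only [integral_const, probReal_univ, smul_eq_mul, mul_one]
    ring

/-- The masses converge almost surely, and the limit is not almost surely zero. -/
theorem ae_exists_tendsto_cascadeMass :
    (∀ᵐ W ∂envLaw ν, ∃ L, Tendsto (fun n => cascadeMass n W) atTop (𝓝 L)) ∧
      ¬ ∀ᵐ W ∂envLaw ν, Tendsto (fun n => cascadeMass n W) atTop (𝓝 0) := by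
  obtain ⟨C, lam, hlam0, hlam1, hC⟩ := exists_integral_sub_sq_le hν hA
  -- a rate for the `L²` norms, positive also if `lam = 0`
  obtain ⟨κ, hκ1, hκ2⟩ := exists_between hlam1
  have hκ0 : 0 < κ := hlam0.trans_lt hκ1
  set σ := √κ with hσ
  have hσ0 : 0 < σ := Real.sqrt_pos.2 hκ0
  have hσ1 : σ < 1 := (Real.sqrt_lt' one_pos).2 (by simpa using hκ2)
  have hσκ : κ = σ * σ := (Real.mul_self_sqrt hκ0.le).symm
  set d : ℕ → Env → ℝ := fun n W => cascadeMass (n + 1) W - cascadeMass n W with hd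
  have hdm : ∀ n, Measurable (d n) := fun n =>
    (measurable_cascadeMass (n + 1)).sub (measurable_cascadeMass n)
  have hZ : ∀ n, Integrable (cascadeMass n) (envLaw ν) := fun n =>
    integrable_cascadeMass_comp hν n continuous_id
  have hdi : ∀ n, Integrable (d n) (envLaw ν) := fun n => (hZ (n + 1)).sub (hZ n)
  have hC0 : 0 ≤ C := by
    have := hC 0
    rw [pow_zero, mul_one] at this
    exact (integral_nonneg fun _ => sq_nonneg _).trans this
  have hdi2 : ∀ n, Integrable (fun W => d n W ^ 2) (envLaw ν) := by
    intro n
    refine Integrable.of_bound ((hdm n).pow_const 2).aestronglyMeasurable ((2 ^ (n + 1)) ^ 2) ?_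
    filter_upwards [ae_envLaw_of_ae ν hν] with W hW
    have h1 := cascadeMass_mem_Icc hW (n + 1)
    have h2 := cascadeMass_mem_Icc hW n
    have h3 : (2 : ℝ) ^ n ≤ 2 ^ (n + 1) := pow_le_pow_right₀ (by norm_num) (by omega)
    rw [Real.norm_eq_abs, abs_pow]
    refine pow_le_pow_left₀ (abs_nonneg _) ?_ 2
    rw [abs_le]
    constructor <;> simp only [hd] <;> linarith [h1.1, h1.2, h2.1, h2.2]
  have hdL1 : ∀ n, ∫ W, ‖d n W‖ ∂envLaw ν ≤ (C + 1) / 2 * σ ^ n := by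
    intro n
    have hσn : 0 < σ ^ n := pow_pos hσ0 n
    have hpt : ∀ W, ‖d n W‖ ≤ (σ ^ n)⁻¹ / 2 * d n W ^ 2 + σ ^ n / 2 := by
      intro W
      have h3 : 0 ≤ (‖d n W‖ - σ ^ n) ^ 2 / (2 * σ ^ n) := by positivity
      have h4 : (σ ^ n)⁻¹ / 2 * d n W ^ 2 + σ ^ n / 2 - ‖d n W‖ =
          (‖d n W‖ - σ ^ n) ^ 2 / (2 * σ ^ n) := by
        rw [← sq_abs (d n W), ← Real.norm_eq_abs]
        field_simp
        ring
      linarith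
    calc ∫ W, ‖d n W‖ ∂envLaw ν
        ≤ ∫ W, ((σ ^ n)⁻¹ / 2 * d n W ^ 2 + σ ^ n / 2) ∂envLaw ν :=
          integral_mono (hdi n).norm (((hdi2 n).const_mul _).add (integrable_const _)) hpt
      _ = (σ ^ n)⁻¹ / 2 * ∫ W, d n W ^ 2 ∂envLaw ν + σ ^ n / 2 := by
          rw [integral_add ((hdi2 n).const_mul _) (integrable_const _), integral_const_mul]
          simp
      _ ≤ (σ ^ n)⁻¹ / 2 * (C * κ ^ n) + σ ^ n / 2 := by
          gcongr
          refine (hC n).trans ?_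
          gcongr
      _ = (C + 1) / 2 * σ ^ n := by
          rw [hσκ, mul_pow]
          field_simp
  have hsumm : Summable fun n => ∫ W, ‖d n W‖ ∂envLaw ν :=
    Summable.of_nonneg_of_le (fun n => integral_nonneg fun _ => norm_nonneg _) hdL1
      ((summable_geometric_of_lt_one hσ0.le hσ1).mul_left _)
  have hae : ∀ᵐ W ∂envLaw ν, Summable fun n => ‖d n W‖ := by
    refine summable_norm_of_tsum_eLpNorm_ne_top le_rfl (fun n => (hdi n).1) ?_
    have e : ∀ n, eLpNorm (d n) 1 (envLaw ν) = ENNReal.ofReal (∫ W, ‖d n W‖ ∂envLaw ν) := by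
      intro n
      rw [eLpNorm_one_eq_lintegral_enorm, ofReal_integral_norm_eq_lintegral_enorm (hdi n)]
    simp_rw [e]
    rw [← ENNReal.ofReal_tsum_of_nonneg (fun n => integral_nonneg fun _ => norm_nonneg _) hsumm]
    exact ENNReal.ofReal_ne_top
  have hlim : ∀ᵐ W ∂envLaw ν,
      Tendsto (fun n => cascadeMass n W) atTop (𝓝 (1 + ∑' n, d n W)) := by
    filter_upwards [hae] with W hW
    have h1 := (hW.of_norm.hasSum.tendsto_sum_nat).const_add 1
    refine h1.congr fun n => ?_
    have : ∑ k ∈ Finset.range n, d k W = cascadeMass n W - cascadeMass 0 W :=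
      Finset.sum_range_sub (fun k => cascadeMass k W) n
    rw [this, cascadeMass.eq_1]
    ring
  refine ⟨hlim.mono fun W h => ⟨_, h⟩, fun hzero => ?_⟩
  have h1 := hasSum_integral_of_summable_integral_norm hdi hsumm
  have h2 : ∀ n, ∫ W, d n W ∂envLaw ν = 0 := by
    intro n
    rw [hd, integral_sub (hZ (n + 1)) (hZ n), integral_cascadeMass hν hA,
      integral_cascadeMass hν hA, sub_self]
  simp_rw [h2] at h1
  have h3 := h1.unique hasSum_zero
  have h4 : ∀ᵐ W ∂envLaw ν, ∑' n, d n W = -1 := by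
    filter_upwards [hlim, hzero] with W ha hb
    have := tendsto_nhds_unique ha hb
    linarith
  rw [integral_congr_ae h4] at h3
  norm_num at h3

/-- The limit of the masses is almost surely positive: it vanishes if and only if the limits of
the two subenvironments do, so that the probability `q` of this event satisfies `q = q ^ 2`. -/
theorem ae_exists_pos_tendsto_cascadeMass :
    ∀ᵐ W ∂envLaw ν, ∃ L, 0 < L ∧ Tendsto (fun n => cascadeMass n W) atTop (𝓝 L) := by
  obtain ⟨hconv, hnz⟩ := ae_exists_tendsto_cascadeMass hν hA
  let R : Env → ℝ := fun W => limUnder atTop fun n => cascadeMass n W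
  have hRm : Measurable R :=
    (StronglyMeasurable.limUnder fun n => (measurable_cascadeMass n).stronglyMeasurable).measurable
  have hR : ∀ᵐ W ∂envLaw ν, Tendsto (fun n => cascadeMass n W) atTop (𝓝 (R W)) := by
    filter_upwards [hconv] with W hW
    exact tendsto_nhds_limUnder hW
  have hR0 : ∀ᵐ W ∂envLaw ν, 0 ≤ R W := by
    filter_upwards [hR, ae_envLaw_of_ae ν hν] with W h1 h2
    exact ge_of_tendsto' h1 fun n => (cascadeMass_mem_Icc h2 n).1
  let g : Env → ℝ := ({0} : Set ℝ).indicator 1 ∘ R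
  have hg : Measurable g := (measurable_one.indicator (measurableSet_singleton 0)).comp hRm
  have hg01 : ∀ W, g W = if R W = 0 then 1 else 0 := fun W => by
    simp only [g, Function.comp_apply, Set.indicator_apply, Set.mem_singleton_iff, Pi.one_apply]
  have hprod : ∀ᵐ W ∂envLaw ν, g W = 1 * (g (shift 0 W) * g (shift 1 W)) := by
    have m0 := (measurePreserving_shift ν 0).quasiMeasurePreserving
    have m1 := (measurePreserving_shift ν 1).quasiMeasurePreserving
    filter_upwards [hR, m0.ae hR, m1.ae hR, m0.ae hR0, m1.ae hR0, ae_envLaw_of_ae ν hν] with W t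
      t0 t1 p0 p1 hW
    have h1 : R W = W [] 0 * R (shift 0 W) + W [] 1 * R (shift 1 W) :=
      tendsto_nhds_unique ((tendsto_add_atTop_iff_nat 1).2 t)
        ((t0.const_mul (W [] 0)).add (t1.const_mul (W [] 1)))
    have w0 := (hW [] 0).1
    have w1 := (hW [] 1).1
    have h2 : R W = 0 ↔ R (shift 0 W) = 0 ∧ R (shift 1 W) = 0 := by
      rw [h1, add_eq_zero_iff_of_nonneg (mul_nonneg w0.le p0) (mul_nonneg w1.le p1)]
      simp [w0.ne', w1.ne']
    rw [hg01, hg01, hg01, if_congr h2 rfl rfl]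
    split_ifs <;> simp_all
  have hq := integral_root_mul_shift_mul_shift ν (f := fun _ => 1) measurable_const hg hg
  rw [← integral_congr_ae hprod] at hq
  simp only [integral_const, probReal_univ, smul_eq_mul, mul_one, one_mul] at hq
  have hgi : Integrable g (envLaw ν) := by
    refine Integrable.of_bound hg.aestronglyMeasurable 1 (Eventually.of_forall fun W => ?_)
    rw [hg01]
    split_ifs <;> simp
  have hg1 : ∀ W, g W ≤ 1 := fun W => by
    rw [hg01]
    split_ifs <;> simp
  have hg0 : ∀ W, 0 ≤ g W := fun W => by
    rw [hg01]
    split_ifs <;> simp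
  have hq0 : ∫ W, g W ∂envLaw ν = 0 := by
    by_contra hne
    have h1 : ∫ W, g W ∂envLaw ν = ∫ _, (1 : ℝ) ∂envLaw ν := by
      simp only [integral_const, probReal_univ, smul_eq_mul, mul_one]
      exact mul_left_cancel₀ hne (by rw [← hq, mul_one])
    have h2 := (integral_eq_iff_of_ae_le hgi (integrable_const _)
      (Eventually.of_forall hg1)).1 h1
    refine hnz ?_
    filter_upwards [h2, hR] with W h3 h4
    have h5 : R W = 0 := by
      by_contra h6
      rw [hg01, if_neg h6] at h3
      exact zero_ne_one h3
    rwa [h5] at h4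
  have h1 := (integral_eq_zero_iff_of_nonneg hg0 hgi).1 hq0
  filter_upwards [h1, hR, hR0] with W h2 h3 h4
  refine ⟨R W, lt_of_le_of_ne h4 fun h5 => ?_, h3⟩
  rw [hg01, if_pos h5.symm] at h2
  exact one_ne_zero h2

end moments

/-! ### The moments of the resistances -/

/-- The limit of the masses of the cascade over the first two letters. -/
noncomputable def limitMass (W : Env) : ℝ := limUnder atTop fun n => cascadeMass n W

theorem measurable_limitMass : Measurable limitMass :=
  (StronglyMeasurable.limUnder fun n => (measurable_cascadeMass n).stronglyMeasurable).measurable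

/-- The sum of the `β`-th powers of the resistances of the edges of level `n`. -/
noncomputable def resistanceSum (β : ℝ) : ℕ → Env → ENNReal
  | 0, W => ENNReal.ofReal (limitMass W) ^ β
  | n + 1, W => ∑ a, ENNReal.ofReal (W [] a) ^ β * resistanceSum β n (shift a W)

theorem measurable_resistanceSum (β : ℝ) (n : ℕ) : Measurable (resistanceSum β n) := by
  induction n with
  | zero => exact measurable_limitMass.ennreal_ofReal.pow_const β
  | succ n ih =>
    exact Finset.measurable_fun_sum _ fun a _ =>
      ((measurable_root a).ennreal_ofReal.pow_const β).mul (ih.comp (measurable_shift a))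

section moments

variable {ν : Measure (Fin 3 → ℝ)} [IsProbabilityMeasure ν]

theorem lintegral_resistanceSum (β : ℝ) (n : ℕ) :
    ∫⁻ W, resistanceSum β n W ∂envLaw ν =
      (∑ a : Fin 3, ∫⁻ x, ENNReal.ofReal (x a) ^ β ∂ν) ^ n *
        ∫⁻ W, resistanceSum β 0 W ∂envLaw ν := by
  induction n with
  | zero => simp
  | succ n ih =>
    rw [pow_succ', mul_assoc, ← ih, Finset.sum_mul]
    simp only [resistanceSum]
    refine (lintegral_finsetSum _ fun a _ =>
      ((measurable_root a).ennreal_ofReal.pow_const β).mul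
        ((measurable_resistanceSum β n).comp (measurable_shift a))).trans ?_
    refine Finset.sum_congr rfl fun a _ => ?_
    exact lintegral_root_mul_shift ν a (f := fun x => ENNReal.ofReal (x a) ^ β)
      ((measurable_pi_apply a).ennreal_ofReal.pow_const β) (measurable_resistanceSum β n)

variable (hν : ∀ᵐ x ∂ν, ∀ j, 0 < x j ∧ x j ≤ 1) (hA : ∫ x, (x 0 + x 1) ∂ν = 1)

include hν

/-- Beyond the exponent `α` the weights have a `β`-sum of mean less than `1`. -/
theorem sum_lintegral_rpow_lt_one {α β : ℝ} (hα0 : 0 < α) (hαβ : α < β)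
    (hα : ∫ x : Fin 3 → ℝ, ∑ a, x a ^ α ∂ν = 1) :
    ∃ lam : ℝ, lam < 1 ∧ ∑ a : Fin 3, ∫⁻ x, ENNReal.ofReal (x a) ^ β ∂ν = ENNReal.ofReal lam := by
  have hint : ∀ γ : ℝ, 0 < γ → Integrable (fun x : Fin 3 → ℝ => ∑ a, x a ^ γ) ν := by
    intro γ hγ
    refine Integrable.of_bound (Measurable.aestronglyMeasurable (by fun_prop)) 3 ?_
    filter_upwards [hν] with x hx
    rw [Real.norm_of_nonneg (Finset.sum_nonneg fun a _ => Real.rpow_nonneg (hx a).1.le γ)]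
    calc ∑ a, x a ^ γ ≤ ∑ _a : Fin 3, (1 : ℝ) :=
          Finset.sum_le_sum fun a _ => Real.rpow_le_one (hx a).1.le (hx a).2 hγ.le
      _ = 3 := by simp
  have hterm : ∀ᵐ x ∂ν, ∀ a, x a ^ β ≤ x a ^ α := by
    filter_upwards [hν] with x hx a
    exact Real.rpow_le_rpow_of_exponent_ge (hx a).1 (hx a).2 hαβ.le
  have hle : (fun x : Fin 3 → ℝ => ∑ a, x a ^ β) ≤ᵐ[ν] fun x => ∑ a, x a ^ α := by
    filter_upwards [hterm] with x hx
    exact Finset.sum_le_sum fun a _ => hx a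
  have hβ0 : 0 < β := hα0.trans hαβ
  refine ⟨∫ x : Fin 3 → ℝ, ∑ a, x a ^ β ∂ν, lt_of_le_of_ne ?_ fun h => ?_, ?_⟩
  · rw [← hα]
    exact integral_mono_ae (hint β hβ0) (hint α hα0) hle
  · have h2 := (integral_eq_iff_of_ae_le (hint β hβ0) (hint α hα0) hle).1 (h.trans hα.symm)
    have h3 : ∀ᵐ x ∂ν, ∑ a : Fin 3, x a ^ α = 3 := by
      filter_upwards [hν, hterm, h2] with x hx ht he
      have h4 : ∀ a, x a = 1 := by
        intro a
        have h5 := (Finset.sum_eq_sum_iff_of_le fun a _ => ht a).1 he a (Finset.mem_univ a)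
        by_contra hne
        exact (Real.rpow_lt_rpow_of_exponent_gt (hx a).1 (lt_of_le_of_ne (hx a).2 hne) hαβ).ne h5
      simp [h4]
    rw [integral_congr_ae h3] at hα
    norm_num at hα
  · have hm : ∀ a : Fin 3, Measurable fun x : Fin 3 → ℝ => ENNReal.ofReal (x a) ^ β := fun a =>
      (measurable_pi_apply a).ennreal_ofReal.pow_const β
    rw [← lintegral_finsetSum _ fun a _ => hm a, ofReal_integral_eq_lintegral_ofReal (hint β hβ0)]
    · refine lintegral_congr_ae ?_
      filter_upwards [hν] with x hx
      rw [ENNReal.ofReal_sum_of_nonneg fun a _ => Real.rpow_nonneg (hx a).1.le β]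
      exact Finset.sum_congr rfl fun a _ => ENNReal.ofReal_rpow_of_pos (hx a).1
    · filter_upwards [hν] with x hx
      exact Finset.sum_nonneg fun a _ => Real.rpow_nonneg (hx a).1.le β

include hA

/-- The limit of the masses has finite moments of all orders, by Fatou's lemma. -/
theorem lintegral_resistanceSum_zero_lt_top {β : ℝ} (hβ : 0 < β) :
    ∫⁻ W, resistanceSum β 0 W ∂envLaw ν < ⊤ := by
  obtain ⟨p, hp⟩ := exists_nat_ge β
  obtain ⟨K, hK⟩ := exists_integral_cascadeMass_pow_le hν hA p
  have hlim : ∀ᵐ W ∂envLaw ν, resistanceSum β 0 W ≤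
      liminf (fun n => ENNReal.ofReal (cascadeMass n W) ^ β) atTop := by
    filter_upwards [ae_exists_pos_tendsto_cascadeMass hν hA] with W hW
    obtain ⟨L, -, hL⟩ := hW
    have h1 : limitMass W = L := hL.limUnder_eq
    have h2 := (ENNReal.continuous_rpow_const (y := β)).tendsto (ENNReal.ofReal L)
    have h3 := h2.comp (ENNReal.tendsto_ofReal hL)
    rw [resistanceSum, h1]
    exact h3.liminf_eq.ge
  have hbound : ∀ n, ∫⁻ W, ENNReal.ofReal (cascadeMass n W) ^ β ∂envLaw ν ≤
      1 + ENNReal.ofReal K := by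
    intro n
    have hpt : ∀ᵐ W ∂envLaw ν, ENNReal.ofReal (cascadeMass n W) ^ β ≤
        1 + ENNReal.ofReal (cascadeMass n W ^ p) := by
      filter_upwards [ae_envLaw_of_ae ν hν] with W hW
      have h0 := (cascadeMass_mem_Icc hW n).1
      rw [ENNReal.ofReal_rpow_of_nonneg h0 hβ.le, ← ENNReal.ofReal_one,
        ← ENNReal.ofReal_add zero_le_one (pow_nonneg h0 p)]
      refine ENNReal.ofReal_le_ofReal ?_
      rcases le_total (cascadeMass n W) 1 with h1 | h1
      · have := Real.rpow_le_one h0 h1 hβ.le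
        have := pow_nonneg h0 p
        linarith
      · have := Real.rpow_le_rpow_of_exponent_le h1 hp
        rw [Real.rpow_natCast] at this
        linarith
    refine (lintegral_mono_ae hpt).trans ?_
    rw [lintegral_add_left measurable_const, lintegral_const, measure_univ, mul_one]
    gcongr
    rw [← ofReal_integral_eq_lintegral_ofReal
      (integrable_cascadeMass_comp hν n (continuous_pow p))]
    · exact ENNReal.ofReal_le_ofReal (hK n)
    · filter_upwards [ae_envLaw_of_ae ν hν] with W hW
      exact pow_nonneg (cascadeMass_mem_Icc hW n).1 p
  refine (lintegral_mono_ae hlim).trans_lt ?_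
  refine (lintegral_liminf_le fun n =>
    (measurable_cascadeMass n).ennreal_ofReal.pow_const β).trans_lt ?_
  refine ((liminf_le_liminf (Eventually.of_forall hbound)).trans_eq
    (liminf_const (1 + ENNReal.ofReal K))).trans_lt ?_
  exact ENNReal.add_lt_top.2 ⟨ENNReal.one_lt_top, ENNReal.ofReal_lt_top⟩

/-- Almost surely the `β`-sums of the resistances decay geometrically, for `β > α`. -/
theorem ae_exists_resistanceSum_le {α β : ℝ} (hα0 : 0 < α) (hαβ : α < β)
    (hα : ∫ x : Fin 3 → ℝ, ∑ a, x a ^ α ∂ν = 1) :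
    ∀ᵐ W ∂envLaw ν, ∃ C ρ : ℝ, 0 < ρ ∧ ρ < 1 ∧
      ∀ n, resistanceSum β n W ≤ ENNReal.ofReal (C * ρ ^ n) := by
  obtain ⟨lam, hlam1, hlam⟩ := sum_lintegral_rpow_lt_one hν hα0 hαβ hα
  obtain ⟨κ, hκ, hκ1⟩ := exists_between (max_lt hlam1 one_pos)
  have hκ0 : 0 < κ := (le_max_right _ _).trans_lt hκ
  have hlamκ : lam < κ := (le_max_left _ _).trans_lt hκ
  have hm : ∀ n, Measurable fun W : Env => ENNReal.ofReal κ⁻¹ ^ n * resistanceSum β n W := fun n =>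
    (measurable_resistanceSum β n).const_mul _
  have hfin : ∫⁻ W, ∑' n, ENNReal.ofReal κ⁻¹ ^ n * resistanceSum β n W ∂envLaw ν ≠ ⊤ := by
    rw [lintegral_tsum fun n => (hm n).aemeasurable]
    have e : ∀ n, ∫⁻ W, ENNReal.ofReal κ⁻¹ ^ n * resistanceSum β n W ∂envLaw ν =
        ENNReal.ofReal (κ⁻¹ * lam) ^ n * ∫⁻ W, resistanceSum β 0 W ∂envLaw ν := by
      intro n
      rw [lintegral_const_mul _ (measurable_resistanceSum β n), lintegral_resistanceSum, hlam,
        ENNReal.ofReal_mul (inv_nonneg.2 hκ0.le), mul_pow, mul_assoc]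
    simp_rw [e]
    rw [ENNReal.tsum_mul_right, ENNReal.tsum_geometric]
    refine ENNReal.mul_ne_top (ENNReal.inv_ne_top.2 ?_)
      (lintegral_resistanceSum_zero_lt_top hν hA (hα0.trans hαβ)).ne
    have h1 : ENNReal.ofReal (κ⁻¹ * lam) < 1 := by
      rw [ENNReal.ofReal_lt_one, inv_mul_lt_one₀ hκ0]
      exact hlamκ
    exact (tsub_pos_of_lt h1).ne'
  filter_upwards [ae_lt_top (Measurable.tsum hm) hfin] with W hW
  refine ⟨(∑' n, ENNReal.ofReal κ⁻¹ ^ n * resistanceSum β n W).toReal, κ, hκ0, hκ1, fun n => ?_⟩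
  rw [ENNReal.ofReal_mul ENNReal.toReal_nonneg, ENNReal.ofReal_toReal hW.ne,
    ENNReal.ofReal_pow hκ0.le]
  have h1 : ENNReal.ofReal κ⁻¹ ^ n * ENNReal.ofReal κ ^ n = 1 := by
    rw [← mul_pow, ← ENNReal.ofReal_mul (inv_nonneg.2 hκ0.le), inv_mul_cancel₀ hκ0.ne',
      ENNReal.ofReal_one, one_pow]
  calc resistanceSum β n W = ENNReal.ofReal κ⁻¹ ^ n * resistanceSum β n W *
        ENNReal.ofReal κ ^ n := by rw [mul_right_comm, h1, one_mul]
    _ ≤ _ := by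
        gcongr
        exact ENNReal.le_tsum n

end moments

/-! ### Realisations of the cascade -/

/-- The environment of a realisation of the weights. -/
def envOf (w : List (Fin 3) → ℝ) : Env := fun i j => w (i ++ [j])

theorem cascadeLength_nil (w : List (Fin 3) → ℝ) : cascadeLength w [] = 1 := by
  simp [cascadeLength]

theorem cascadeLength_cons (w : List (Fin 3) → ℝ) (a : Fin 3) (i : List (Fin 3)) :
    cascadeLength w (a :: i) = w [a] * cascadeLength (fun j => w (a :: j)) i := by
  rw [cascadeLength, List.length_cons, Finset.prod_range_succ', mul_comm]
  simp [cascadeLength]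

theorem sum_cascadeLength_eq_cascadeMass (w : List (Fin 3) → ℝ) (n : ℕ) :
    ∑ j : Fin n → Fin 2, cascadeLength w (List.ofFn fun k => (j k).castSucc) =
      cascadeMass n (envOf w) := by
  induction n generalizing w with
  | zero => simp [cascadeLength_nil, cascadeMass]
  | succ n ih =>
    rw [← (Fin.consEquiv fun _ : Fin (n + 1) => Fin 2).sum_comp, Fintype.sum_prod_type,
      Fin.sum_univ_two]
    simp only [Fin.consEquiv, Equiv.coe_fn_mk, List.ofFn_succ, Fin.cons_zero, Fin.cons_succ,
      cascadeLength_cons]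
    rw [← Finset.mul_sum, ← Finset.mul_sum, ih, ih]
    rfl

theorem resistancePerturbation_nil (w : List (Fin 3) → ℝ) :
    resistancePerturbation w [] = limitMass (envOf w) := by
  simp only [resistancePerturbation, List.nil_append, cascadeLength_nil, div_one,
    sum_cascadeLength_eq_cascadeMass]
  rfl

theorem resistancePerturbation_cons {w : List (Fin 3) → ℝ} {a : Fin 3} (ha : w [a] ≠ 0)
    (i : List (Fin 3)) :
    resistancePerturbation w (a :: i) = resistancePerturbation (fun j => w (a :: j)) i := by
  simp only [resistancePerturbation, List.cons_append, cascadeLength_cons,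
    mul_div_mul_left _ _ ha]

theorem edgeResistance_nil (w : List (Fin 3) → ℝ) :
    edgeResistance w [] = limitMass (envOf w) := by
  rw [edgeResistance, cascadeLength_nil, one_mul, resistancePerturbation_nil]

theorem edgeResistance_cons {w : List (Fin 3) → ℝ} {a : Fin 3} (ha : w [a] ≠ 0)
    (i : List (Fin 3)) :
    edgeResistance w (a :: i) = w [a] * edgeResistance (fun j => w (a :: j)) i := by
  rw [edgeResistance, edgeResistance, cascadeLength_cons, resistancePerturbation_cons ha, mul_assoc]

/-- An environment with weights in `(0, 1]` in which the masses of all subenvironments converge to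
positive limits. -/
structure IsRegularEnv (W : Env) : Prop where
  weight : ∀ i j, 0 < W i j ∧ W i j ≤ 1
  mass : ∀ i, ∃ L, 0 < L ∧ Tendsto (fun n => cascadeMass n fun j => W (i ++ j)) atTop (𝓝 L)

theorem IsRegularEnv.subenv {W : Env} (hW : IsRegularEnv W) (a : Fin 3) :
    IsRegularEnv (shift a W) :=
  ⟨fun _ j => hW.weight _ j, fun i => hW.mass (a :: i)⟩

theorem IsRegularEnv.tendsto_limitMass {W : Env} (hW : IsRegularEnv W) :
    Tendsto (fun n => cascadeMass n W) atTop (𝓝 (limitMass W)) := by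
  obtain ⟨L, -, hL⟩ := hW.mass []
  exact tendsto_nhds_limUnder ⟨L, hL⟩

theorem IsRegularEnv.limitMass_pos {W : Env} (hW : IsRegularEnv W) : 0 < limitMass W := by
  obtain ⟨L, hL0, hL⟩ := hW.mass []
  rwa [tendsto_nhds_unique hW.tendsto_limitMass hL]

theorem IsRegularEnv.limitMass_eq {W : Env} (hW : IsRegularEnv W) :
    limitMass W = W [] 0 * limitMass (shift 0 W) + W [] 1 * limitMass (shift 1 W) :=
  tendsto_nhds_unique ((tendsto_add_atTop_iff_nat 1).2 hW.tendsto_limitMass)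
    (((hW.subenv 0).tendsto_limitMass.const_mul _).add
      ((hW.subenv 1).tendsto_limitMass.const_mul _))

theorem isResistanceWeight_edgeResistance {w : List (Fin 3) → ℝ} (hw : IsRegularEnv (envOf w)) :
    IsResistanceWeight (edgeResistance w) := by
  have hne : ∀ {w : List (Fin 3) → ℝ}, IsRegularEnv (envOf w) → ∀ a, 0 < w [a] :=
    fun hw a => (hw.weight [] a).1
  constructor
  · intro i
    induction i generalizing w with
    | nil =>
      rw [edgeResistance_nil]
      exact hw.limitMass_pos
    | cons a i ih =>
      rw [edgeResistance_cons (hne hw a).ne']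
      exact mul_pos (hne hw a) (ih (w := fun j => w (a :: j)) (hw.subenv a))
  · intro i
    induction i generalizing w with
    | nil =>
      rw [List.nil_append, List.nil_append, edgeResistance_cons (hne hw 0).ne',
        edgeResistance_cons (hne hw 1).ne', edgeResistance_nil, edgeResistance_nil,
        edgeResistance_nil]
      exact hw.limitMass_eq
    | cons a i ih =>
      rw [List.cons_append, List.cons_append, edgeResistance_cons (hne hw a).ne',
        edgeResistance_cons (hne hw a).ne', edgeResistance_cons (hne hw a).ne',
        ih (w := fun j => w (a :: j)) (hw.subenv a), mul_add]

theorem ofReal_sum_edgeResistance_rpow {w : List (Fin 3) → ℝ} (hw : IsRegularEnv (envOf w))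
    (β : ℝ) (n : ℕ) : ENNReal.ofReal (∑ i ∈ words n, edgeResistance w i ^ β) =
      resistanceSum β n (envOf w) := by
  have hpos := (isResistanceWeight_edgeResistance hw).pos
  rw [ENNReal.ofReal_sum_of_nonneg fun i _ => Real.rpow_nonneg (hpos i).le β]
  simp_rw [← ENNReal.ofReal_rpow_of_pos (hpos _)]
  induction n generalizing w with
  | zero => rw [sum_words_zero, edgeResistance_nil, resistanceSum]
  | succ n ih =>
    rw [sum_words_succ, resistanceSum]
    refine Finset.sum_congr rfl fun a _ => ?_
    have ha : 0 < w [a] := (hw.weight [] a).1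
    have e : envOf (fun j => w (a :: j)) = shift a (envOf w) := rfl
    rw [← e, ← ih (w := fun j => w (a :: j)) (hw.subenv a)
      (isResistanceWeight_edgeResistance (w := fun j => w (a :: j)) (hw.subenv a)).pos,
      Finset.mul_sum]
    refine Finset.sum_congr rfl fun i _ => ?_
    rw [edgeResistance_cons ha.ne', ENNReal.ofReal_mul ha.le,
      ENNReal.mul_rpow_of_ne_top ENNReal.ofReal_ne_top ENNReal.ofReal_ne_top]
    rfl

theorem ae_isRegularEnv {ν : Measure (Fin 3 → ℝ)} [IsProbabilityMeasure ν]
    (hν : ∀ᵐ x ∂ν, ∀ j, 0 < x j ∧ x j ≤ 1) (hA : ∫ x, (x 0 + x 1) ∂ν = 1) :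
    ∀ᵐ W ∂envLaw ν, IsRegularEnv W := by
  have h1 : ∀ᵐ W ∂envLaw ν, ∀ i : List (Fin 3),
      ∃ L, 0 < L ∧ Tendsto (fun n => cascadeMass n fun j => W (i ++ j)) atTop (𝓝 L) := by
    refine ae_all_iff.2 fun i => ?_
    have hmp : MeasurePreserving (fun (W : Env) j => W (i ++ j)) (envLaw ν) (envLaw ν) :=
      ⟨measurable_pi_lambda _ fun j => measurable_pi_apply (i ++ j),
        Measure.map_infinitePi_infinitePi_of_inj (P := fun _ : List (Fin 3) => ν)
          fun j k h => List.append_cancel_left h⟩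
    exact hmp.quasiMeasurePreserving.ae (ae_exists_pos_tendsto_cascadeMass hν hA)
  filter_upwards [ae_envLaw_of_ae ν hν, h1] with W h2 h3
  exact ⟨h2, h3⟩

theorem IsMultiplicativeCascade.map_envOf {Ω : Type*} [MeasurableSpace Ω] {P : Measure Ω}
    [IsProbabilityMeasure P] {w : List (Fin 3) → Ω → ℝ} (hw : IsMultiplicativeCascade P w)
    [IsProbabilityMeasure (P.map fun ω j => w [j] ω)] :
    P.map (fun ω => envOf fun i => w i ω) = envLaw (P.map fun ω j => w [j] ω) := by
  have hm : ∀ i : List (Fin 3), Measurable fun (ω : Ω) (j : Fin 3) => w (i ++ [j]) ω := fun i =>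
    measurable_pi_lambda _ fun j => hw.measurable _ (by simp)
  have := hw.indep.map_fun_eq_infinitePi_map hm
  simp_rw [(hw.identDistrib _).map_eq] at this
  exact this

theorem mainTheorem3 {Ω : Type*} [MeasurableSpace Ω] (P : Measure Ω) [IsProbabilityMeasure P]
    (w : List (Fin 3) → Ω → ℝ) (hw : IsMultiplicativeCascade P w)
    (hw_ne : ∀ i, i ≠ [] → ∀ᵐ ω ∂P, w i ω ≠ 0)
    (hA : ∫ ω, (w [0] ω + w [1] ω) ∂P = 1)
    (hB : ∑ a : Fin 3, P {ω | w [a] ω = 1} < 1)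
    (c : ℝ) (hc_pos : 0 < c) (hc_lt : c < 1 / 2)
    (T : Set (ℝ × ℝ)) (hT : IsSelfSimilarDendrite c T)
    (α : ℝ) (hα_pos : 0 < α) (hα : ∫ ω, ∑ a : Fin 3, w [a] ω ^ α ∂P = 1) :
    ∀ᵐ ω ∂P, ∃ m : MetricSpace T,
      IsResistanceExtension c (fun i => w i ω) (fun x y : T => m.dist x y) ∧
      @dimH T (@MetricSpace.toEMetricSpace T m) Set.univ ≤ ENNReal.ofReal α := by
  have hm : Measurable fun (ω : Ω) (j : Fin 3) => w [j] ω :=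
    measurable_pi_lambda _ fun j => hw.measurable _ (by simp)
  have : IsProbabilityMeasure (P.map fun ω j => w [j] ω) :=
    Measure.isProbabilityMeasure_map hm.aemeasurable
  set ν := P.map fun ω j => w [j] ω with hνdef
  have hν : ∀ᵐ x ∂ν, ∀ j, 0 < x j ∧ x j ≤ 1 := by
    refine ae_all_iff.2 fun j => (ae_map_iff hm.aemeasurable ?_).2 ?_
    · exact (measurableSet_lt measurable_const (measurable_pi_apply j)).inter
        (measurableSet_le (measurable_pi_apply j) measurable_const)
    · filter_upwards [hw.mem_Icc [j] (by simp), hw_ne [j] (by simp)] with ω h1 h2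
      exact ⟨lt_of_le_of_ne h1.1 h2.symm, h1.2⟩
  have hA' : ∫ x, (x 0 + x 1) ∂ν = 1 := by
    rw [hνdef, integral_map hm.aemeasurable (Measurable.aestronglyMeasurable (by fun_prop))]
    exact hA
  have hα' : ∫ x : Fin 3 → ℝ, ∑ a, x a ^ α ∂ν = 1 := by
    rw [hνdef, integral_map hm.aemeasurable (Measurable.aestronglyMeasurable (by fun_prop))]
    exact hα
  have hβ : ∀ k : ℕ, α < α + 1 / ((k : ℝ) + 1) := fun k => by
    have : 0 < 1 / ((k : ℝ) + 1) := by positivity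
    linarith
  have hdec : ∀ᵐ W ∂envLaw ν, ∀ k : ℕ, ∃ C ρ : ℝ, 0 < ρ ∧ ρ < 1 ∧
      ∀ n, resistanceSum (α + 1 / ((k : ℝ) + 1)) n W ≤ ENNReal.ofReal (C * ρ ^ n) :=
    ae_all_iff.2 fun k => ae_exists_resistanceSum_le hν hA' hα_pos (hβ k) hα'
  have henv : Measurable fun ω => envOf fun i => w i ω :=
    measurable_pi_lambda _ fun i => measurable_pi_lambda _ fun j => hw.measurable _ (by simp)
  have hall := (ae_isRegularEnv hν hA').and hdec
  rw [← hw.map_envOf] at hall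
  filter_upwards [ae_of_ae_map henv.aemeasurable hall] with ω hω
  obtain ⟨hreg, hd⟩ := hω
  have hr := isResistanceWeight_edgeResistance hreg
  refine exists_metricSpace_of_decay hT hc_pos hc_lt hr hα_pos fun γ hγ => ?_
  obtain ⟨k, hk⟩ := exists_nat_one_div_lt (sub_pos.2 hγ)
  refine ⟨_, hβ k, by linarith, ?_⟩
  obtain ⟨C, ρ, hρ0, hρ1, hC⟩ := hd k
  refine ⟨max C 0, ρ, hρ0, hρ1, fun n => ?_⟩
  have h1 := hC n
  rw [← ofReal_sum_edgeResistance_rpow hreg] at h1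
  have h2 : C * ρ ^ n ≤ max C 0 * ρ ^ n := by
    gcongr
    exact le_max_left _ _
  exact (ENNReal.ofReal_le_ofReal_iff (by positivity)).1 (h1.trans (ENNReal.ofReal_le_ofReal h2))
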